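/- Let $A$ be a unital algebra over $\mathbb{C}$, let $B\subset A$ be a subalgebra with $1_B=1_A$, let $\varphi:A\to\mathbb{C}$ be a linear functional with $\varphi(1)=1$, and let $E:A\to B$ be a linear map with $E(b)=b$ and $E(bab')=bE(a)b'$ for all $b,b'\in B$, $a\in A$. Suppose that $(A,\varphi)$ and $(A,E)$ are compatible, i.e. $\varphi(a)=\varphi(E(a))$ for all $a\in A$. The scalar-valued free cumulants $k_n$ of $\varphi$ are defined by $\varphi(a_1\cdots a_n)=\sum_{\pi\in NC(n)}\prod_{V\in\pi}k_{|V|}\big((a_j)_{j\in V}\big)$, and the $B$-valued free cumulants $C^{(n)}$ of $E$ by $E(a_1\cdots a_n)=\sum_{\pi\in NC(n)}\widehat C(\pi)(a_1\otimes\cdots\otimes a_n)$, where $NC(n)$ is the set of noncrossing partitions of $\{1,\dots,n\}$ and $\widehat C(\pi)$ is obtained by nesting the maps $C^{(m)}$ according to the blocks of $\pi$. Subsets $X_i$ of $A$ are free in $(A,\varphi)$ (respectively $B$-free in $(A,E)$) if all mixed scalar-valued (respectively $B$-valued) cumulants of the subalgebras generated by $X_i$ and $\mathbb{C}1$ (respectively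 by $X_i$ and $B$) vanish. For $a_1,\dots,a_p\in A$, the scalar-valued R-transform is the formal series in noncommuting indeterminates $$r_{a_1,\dots,a_p}(z_1,\dots,z_p)=\sum_{n\ge 1}\ \sum_{i_1,\dots,i_n\in\{1,\dots,p\}}k_n(a_{i_1},\dots,a_{i_n})\,z_{i_1}\cdots z_{i_n}.$$ For two such series $f,g$ without constant term in $z_1,\dots,z_p$, with coefficients $f_{i_1,\dots,i_n}$ and $g_{i_1,\dots,i_n}$, the boxed convolution $f\boxtimes g$ is the series whose coefficient at $z_{i_1}\cdots z_{i_n}$ is $$\sum_{\pi\in NC(n)}\Big(\prod_{V\in\pi}f_{(i_j)_{j\in V}}\Big)\Big(\prod_{W\in Kr(\pi)}g_{(i_j)_{j\in W}}\Big),$$ where $Kr(\pi)$ is the Kreweras complement of $\pi$. Let $s\in\mathbb{N}$ and let $x_1,\dots,x_s,y_1,\dots,y_s\in A$ be such that $\{x_1,\dots,x_s\}$ and $\{y_1,\dots,y_s\}$ are $B$-free in $(A,E)$, and such that $\{x_1,\dots,x_s,y_1,\dots,y_s\}$ and $B$ are free in $(A,\varphi)$. Then (1) $r_{x_1,\dots,x_s,y_1,\dots,y_s}(z_1,\dots,z_{2s})=r_{x_1,\dots,x_s}(z_1,\dots,z_s)+r_{y_1,\dots,y_s}(z_{s+1},\dots,z_{2s})$;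 (2) $r_{x_1+y_1,\dots,x_s+y_s}(z_1,\dots,z_s)=r_{x_1,\dots,x_s}(z_1,\dots,z_s)+r_{y_1,\dots,y_s}(z_1,\dots,z_s)$; (3) $r_{x_1y_1,\dots,x_sy_s}(z_1,\dots,z_s)=\big(r_{x_1,\dots,x_s}\boxtimes r_{y_1,\dots,y_s}\big)(z_1,\dots,z_s)$. -/

import Mathlib

/-! ### Noncrossing partitions -/

/-- A partition of `{0, …, n-1}` is noncrossing if there are no `a < b < c < d` with `a, c` in one
block and `b, d` in a different block. -/
def IsNoncrossing {n : ℕ} (π : Finpartition (Finset.univ : Finset (Fin n))) : Prop :=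
  ∀ V ∈ π.parts, ∀ W ∈ π.parts, ∀ a b c d : Fin n, a < b → b < c → c < d →
    a ∈ V → c ∈ V → b ∈ W → d ∈ W → V = W

open scoped Classical in
/-- The set `NC(n)` of noncrossing partitions. -/
noncomputable def NC (n : ℕ) : Finset (Finpartition (Finset.univ : Finset (Fin n))) :=
  Finset.univ.filter IsNoncrossing

/-- The subword of `l` on the positions in `V`, in increasing order of positions. -/
def subword {α : Type*} (l : List α) (V : Finset (Fin l.length)) : List α :=
  V.sort.map l.get

/-- Placing a point `i'` directly after `i`, so that the points are ordered
`0, 0', 1, 1', …`, the points `i'` and `j'` may be joined without crossing a block of `π` if and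
only if every block of `π` lies inside `(min i j, max i j]` or outside of it. -/
def krewerasSetoid {n : ℕ} (π : Finpartition (Finset.univ : Finset (Fin n))) :
    Setoid (Fin n) where
  r i j := ∀ V ∈ π.parts, ∀ a ∈ V, ∀ b ∈ V,
    (a ∈ Finset.Ioc (min i j) (max i j) ↔ b ∈ Finset.Ioc (min i j) (max i j))
  iseqv :=
    { refl := by
        intro i V _ a _ b _
        simp
      symm := by
        intro i j h
        simpa only [min_comm, max_comm] using h
      trans := by
        intro i j k h1 h2 V hV a ha b hb
        have h1' := h1 V hV a ha b hb
        have h2' := h2 V hV a ha b hb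
        simp only [Finset.mem_Ioc, min_lt_iff, le_max_iff] at h1' h2' ⊢
        grind }

open scoped Classical in
/-- The Kreweras complement `Kr(π)`. -/
noncomputable def kreweras {n : ℕ} (π : Finpartition (Finset.univ : Finset (Fin n))) :
    Finpartition (Finset.univ : Finset (Fin n)) :=
  Finpartition.ofSetoid (krewerasSetoid π)

open scoped Classical in
/-- `Kr(π)` is the largest partition `σ` of `{0', …, (n-1)'}` none of whose blocks crosses a block
of `π` in the ordering `0 < 0' < 1 < 1' < …`. -/
theorem le_kreweras_iff {n : ℕ} (π σ : Finpartition (Finset.univ : Finset (Fin n))) :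
    σ ≤ kreweras π ↔ ∀ V ∈ π.parts, ∀ W ∈ σ.parts, ∀ a ∈ V, ∀ c ∈ V, ∀ b ∈ W, ∀ d ∈ W,
      ¬ (a ≤ b ∧ b < c ∧ c ≤ d) ∧ ¬ (b < a ∧ a ≤ d ∧ d < c) := by
  have key : ∀ i j : Fin n, j ∈ (kreweras π).part i ↔ krewerasSetoid π i j := fun i j =>
    Finpartition.mem_part_ofSetoid_iff_rel
  constructor
  · intro h V hV W hW a ha c hc b hb d hd
    obtain ⟨U, hU, hWU⟩ := h hW
    have hbd : krewerasSetoid π b d := by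
      rw [← key, (kreweras π).part_eq_of_mem hU (hWU hb)]
      exact hWU hd
    have := hbd V hV a ha c hc
    simp only [Finset.mem_Ioc, min_lt_iff, le_max_iff] at this
    grind
  · intro h W hW
    obtain ⟨i, hi⟩ := σ.nonempty_of_mem_parts hW
    refine ⟨(kreweras π).part i, (kreweras π).part_mem.2 (Finset.mem_univ i), ?_⟩
    intro j hj
    rw [key]
    intro V hV a ha b hb
    have h1 := h V hV W hW a ha b hb i hi j hj
    have h2 := h V hV W hW b hb a ha i hi j hj
    have h3 := h V hV W hW a ha b hb j hj i hi
    have h4 := h V hV W hW b hb a ha j hj i hi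
    simp only [Finset.mem_Ioc, min_lt_iff, le_max_iff]
    grind

/-! ### Scalar-valued free cumulants -/

/-- The multiplicative extension `f_π(a_1, …, a_n) = ∏_{V ∈ π} f (a|_V)`. -/
noncomputable def multExt {α : Type*} (f : List α → ℂ) (l : List α)
    (π : Finpartition (Finset.univ : Finset (Fin l.length))) : ℂ :=
  ∏ V ∈ π.parts, f (subword l V)

/-- The scalar-valued free cumulant `k_n(a_1, …, a_n)` of the list `l = [a_1, …, a_n]`, defined by
the moment-cumulant formula `φ(a_1 ⋯ a_n) = ∑_{π ∈ NC(n)} k_π(a_1, …, a_n)` solved for the term of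
`π = 1_n`. The other terms only involve shorter lists, so the test on the length (which makes the
recursion well-founded) is always passed; see `sum_multExt_scalarCumulant`. -/
noncomputable def scalarCumulant {A : Type*} [Ring A] [Algebra ℂ A] (φ : A →ₗ[ℂ] ℂ)
    (l : List A) : ℂ :=
  φ l.prod - ∑ π ∈ (NC l.length).filter (fun π => π.parts ≠ {Finset.univ}),
    multExt (fun l' => if l'.length < l.length then scalarCumulant φ l' else 0) l π
termination_by l.length

/-! ### Operator-valued free cumulants -/

/-- The nested evaluation of `f` along a noncrossing partition `π`, restricted to a set `S` of
positions which is a union of blocks. If `V = {v_1 < ⋯ < v_k}` is the block of the first position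
of `S`, this is `f(a_{v_1}, β_2 a_{v_2}, …, β_k a_{v_k}) · β`, where `β_j` is the nested evaluation
on the positions of `S` strictly between `v_{j-1}` and `v_j`, and `β` is the one on the positions
of `S` after `v_k`. -/
noncomputable def nestedEval {A : Type*} [Ring A] [Algebra ℂ A] {B : Subalgebra ℂ A}
    (f : List A → B) (l : List A) (π : Finpartition (Finset.univ : Finset (Fin l.length)))
    (S : Finset (Fin l.length)) : B :=
  if h : S.Nonempty then
    f ((π.part (S.min' h)).sort.map (fun w =>
        (nestedEval f l π
          (S.filter (fun u => u < w ∧ ∀ v ∈ π.part (S.min' h), v < w → v < u)) : A) * l.get w)) *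
      nestedEval f l π (S.filter (fun u => ∀ v ∈ π.part (S.min' h), v < u))
  else 1
termination_by S.card
decreasing_by
  · refine Finset.card_lt_card (Finset.filter_ssubset.2 ⟨S.min' h, S.min'_mem h, fun hu => ?_⟩)
    exact lt_irrefl _ (hu.2 _ (π.mem_part (Finset.mem_univ _)) hu.1)
  · refine Finset.card_lt_card (Finset.filter_ssubset.2 ⟨S.min' h, S.min'_mem h, fun hu => ?_⟩)
    exact lt_irrefl _ (hu _ (π.mem_part (Finset.mem_univ _)))

/-- The `B`-valued cumulant `C^{(n)}(a_1 ⊗ ⋯ ⊗ a_n)` of the list `l = [a_1, …, a_n]`, defined by the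
moment-cumulant formula `E(a_1 ⋯ a_n) = ∑_{π ∈ NC(n)} Ĉ(π)(a_1 ⊗ ⋯ ⊗ a_n)` solved for the term of
`π = 1_n`. As in the scalar case the test on the length is always passed; see
`sum_nestedEval_opCumulant`. -/
noncomputable def opCumulant {A : Type*} [Ring A] [Algebra ℂ A] {B : Subalgebra ℂ A}
    (E : A →ₗ[ℂ] B) (l : List A) : B :=
  E l.prod - ∑ π ∈ (NC l.length).filter (fun π => π.parts ≠ {Finset.univ}),
    nestedEval (fun l' => if l'.length < l.length then opCumulant E l' else 0) l π Finset.univ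
termination_by l.length

/-! #### The moment-cumulant formulas -/

theorem subword_univ {α : Type*} (l : List α) : subword l Finset.univ = l := by
  unfold subword
  rw [Fin.sort_univ]
  exact List.map_get_finRange l

theorem part_card_lt {n : ℕ} (π : Finpartition (Finset.univ : Finset (Fin n)))
    (h : π.parts ≠ {Finset.univ}) {V : Finset (Fin n)} (hV : V ∈ π.parts) : V.card < n := by
  have hne : V ≠ Finset.univ := by
    rintro rfl
    apply h
    refine Finset.eq_singleton_iff_unique_mem.2 ⟨hV, fun W hW => ?_⟩
    obtain ⟨i, hi⟩ := π.nonempty_of_mem_parts hW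
    exact π.eq_of_mem_parts hW hV hi (Finset.mem_univ i)
  have := Finset.card_lt_card (Finset.ssubset_univ_iff.2 hne)
  simpa using this

theorem sum_NC_eq {M : Type*} [AddCommGroup M] {n : ℕ} (hn : 0 < n)
    (F : Finpartition (Finset.univ : Finset (Fin n)) → M) (c : M)
    (hF : ∀ π, π.parts = {Finset.univ} → F π = c) :
    ∑ π ∈ NC n, F π = c + ∑ π ∈ (NC n).filter (fun π => π.parts ≠ {Finset.univ}), F π := by
  have hne : (Finset.univ : Finset (Fin n)) ≠ ⊥ :=
    (Finset.univ_nonempty_iff.2 ⟨⟨0, hn⟩⟩).ne_empty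
  have h1 : (NC n).filter (fun π => π.parts = {Finset.univ}) = {Finpartition.indiscrete hne} := by
    ext π
    simp only [NC, Finset.mem_filter, Finset.mem_univ, true_and, Finset.mem_singleton]
    constructor
    · rintro ⟨-, h⟩
      exact Finpartition.ext h
    · rintro rfl
      refine ⟨?_, rfl⟩
      intro V hV W hW
      simp only [Finpartition.indiscrete_parts, Finset.mem_singleton] at hV hW
      intros
      rw [hV, hW]
  rw [← Finset.sum_filter_add_sum_filter_not (NC n) (fun π => π.parts = {Finset.univ}), h1,
    Finset.sum_singleton, hF _ rfl]

theorem sum_multExt_scalarCumulant {A : Type*} [Ring A] [Algebra ℂ A] (φ : A →ₗ[ℂ] ℂ)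
    (l : List A) (hl : l ≠ []) :
    φ l.prod = ∑ π ∈ NC l.length, multExt (scalarCumulant φ) l π := by
  rw [sum_NC_eq (List.length_pos_of_ne_nil hl) _ (scalarCumulant φ l)]
  · conv_rhs => rw [scalarCumulant]
    rw [sub_add_eq_add_sub, eq_sub_iff_add_eq]
    congr 1
    refine Finset.sum_congr rfl fun π hπ => Finset.prod_congr rfl fun V hV => ?_
    have := part_card_lt π (Finset.mem_filter.1 hπ).2 hV
    exact if_pos (by simpa [subword] using this)
  · intro π hπ
    simp [multExt, hπ, subword_univ]

theorem nestedEval_congr {A : Type*} [Ring A] [Algebra ℂ A] {B : Subalgebra ℂ A}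
    (f g : List A → B) (l : List A) (π : Finpartition (Finset.univ : Finset (Fin l.length)))
    (hfg : ∀ V ∈ π.parts, ∀ l' : List A, l'.length = V.card → f l' = g l')
    (S : Finset (Fin l.length)) : nestedEval f l π S = nestedEval g l π S := by
  induction hc : S.card using Nat.strong_induction_on generalizing S with
  | _ m ih =>
    rw [nestedEval, nestedEval]
    split_ifs with h
    · have hm : ∀ (p : Fin l.length → Prop) [DecidablePred p], ¬ p (S.min' h) → (S.filter p).card < m := by
        intro p _ hp
        rw [← hc]
        exact Finset.card_lt_card (Finset.filter_ssubset.2 ⟨S.min' h, S.min'_mem h, hp⟩)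
      have hmem := π.mem_part (Finset.mem_univ (S.min' h))
      rw [ih _ (hm _ fun hu => lt_irrefl _ (hu _ hmem)) _ rfl]
      congr 1
      rw [hfg _ (π.part_mem.2 (Finset.mem_univ (S.min' h))) _ (by simp)]
      congr 1
      refine List.map_congr_left fun w _ => ?_
      rw [ih _ (hm _ fun hu => lt_irrefl _ (hu.2 _ hmem hu.1)) _ rfl]
    · rfl

theorem sum_nestedEval_opCumulant {A : Type*} [Ring A] [Algebra ℂ A] {B : Subalgebra ℂ A}
    (E : A →ₗ[ℂ] B) (l : List A) (hl : l ≠ []) :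
    E l.prod = ∑ π ∈ NC l.length, nestedEval (opCumulant E) l π Finset.univ := by
  have hpos := List.length_pos_of_ne_nil hl
  rw [sum_NC_eq hpos _ (opCumulant E l)]
  · conv_rhs => rw [opCumulant]
    rw [sub_add_eq_add_sub, eq_sub_iff_add_eq]
    congr 1
    refine Finset.sum_congr rfl fun π hπ => nestedEval_congr _ _ _ _ (fun V hV l' hl' => ?_) _
    have := part_card_lt π (Finset.mem_filter.1 hπ).2 hV
    exact if_pos (by omega)
  · intro π hπ
    have hne : (Finset.univ : Finset (Fin l.length)).Nonempty :=
      Finset.univ_nonempty_iff.2 ⟨⟨0, hpos⟩⟩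
    have hpart : ∀ a, π.part a = Finset.univ := by
      intro a
      have := π.part_mem.2 (Finset.mem_univ a)
      rwa [hπ, Finset.mem_singleton] at this
    rw [nestedEval, dif_pos hne]
    have h0 : ∀ (p : Fin l.length → Prop) [DecidablePred p], (∀ u, ¬ p u) →
        nestedEval (opCumulant E) l π (Finset.univ.filter p) = 1 := by
      intro p _ hp
      rw [nestedEval, dif_neg]
      simp [hp]
    rw [h0 _ (fun u hu => lt_irrefl _ (hu u (by rw [hpart]; exact Finset.mem_univ u))), mul_one,
      hpart]
    conv_rhs => rw [← subword_univ l]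
    unfold subword
    congr 1
    refine List.map_congr_left fun w _ => ?_
    rw [h0 _ (fun u hu => lt_irrefl _ (hu.2 u (Finset.mem_univ u) hu.1))]
    simp

/-! ### Noncommutative probability spaces and freeness -/

/-- `E : A → B` is a `B`-functional (conditional expectation): it fixes `B` and is a `B`-bimodule
map. -/
def IsBFunctional {A : Type*} [Ring A] [Algebra ℂ A] {B : Subalgebra ℂ A} (E : A →ₗ[ℂ] B) : Prop :=
  (∀ b : B, E b = b) ∧ ∀ (b b' : B) (x : A), E (b * x * b') = b * E x * b'

/-- Compatibility of the scalar-valued space `(A, φ)` with the `B`-valued space `(A, E)`. -/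
def Compatible {A : Type*} [Ring A] [Algebra ℂ A] {B : Subalgebra ℂ A} (φ : A →ₗ[ℂ] ℂ)
    (E : A →ₗ[ℂ] B) : Prop :=
  ∀ a : A, φ a = φ (E a)

/-- All mixed cumulants of the family of sets `S` vanish: `c(a_1, …, a_n) = 0` as soon as
`a_j ∈ S (i_j)` for all `j` and the indices `i_1, …, i_n` are not all equal. -/
def MixedCumulantsVanish {A M ι : Type*} [Zero M] (c : List A → M) (S : ι → Set A) : Prop :=
  ∀ (n : ℕ) (i : Fin n → ι) (a : Fin n → A), (∀ j, a j ∈ S (i j)) → (∃ j k, i j ≠ i k) →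
    c (List.ofFn a) = 0

/-- The subsets `X i` of `A` are free in `(A, φ)`: the mixed cumulants of the unital subalgebras
they generate vanish. -/
def IsFree {A ι : Type*} [Ring A] [Algebra ℂ A] (φ : A →ₗ[ℂ] ℂ) (X : ι → Set A) : Prop :=
  MixedCumulantsVanish (scalarCumulant φ) (fun i => (Algebra.adjoin ℂ (X i) : Set A))

/-- The subsets `X i` of `A` are free over `B` in `(A, E)`: the mixed `B`-valued cumulants of the
subalgebras generated by `B` and `X i` vanish. -/
def IsBFree {A ι : Type*} [Ring A] [Algebra ℂ A] {B : Subalgebra ℂ A} (E : A →ₗ[ℂ] B)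
    (X : ι → Set A) : Prop :=
  MixedCumulantsVanish (opCumulant E) (fun i => (Algebra.adjoin ℂ ((B : Set A) ∪ X i) : Set A))

/-! ### Formal series, R-transforms and boxed convolution -/

/-- Formal series over `ℂ` without constant term in noncommuting indeterminates `z_i`, `i : ι`.
A series is given by its coefficients: the coefficient of `z_{i_1} ⋯ z_{i_n}` is its value at the
word `[i_1, …, i_n]`. -/
def FormalSeries (ι : Type*) : Submodule ℂ (List ι → ℂ) where
  carrier := {f | f [] = 0}
  add_mem' := by
    intro f g hf hg
    simp_all
  zero_mem' := rfl
  smul_mem' := by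
    intro c f hf
    simp_all

/-- The series `f` with the indeterminates renamed along an injection `e`, as a series in the
larger set of indeterminates. -/
noncomputable def FormalSeries.rename {ι κ : Type*} (e : ι ↪ κ) (f : FormalSeries ι) :
    FormalSeries κ :=
  ⟨Function.extend (List.map e) f.1 0, by
    have h := (List.map_injective_iff.2 e.injective).extend_apply f.1 0 []
    exact h.trans f.2⟩

/-- The boxed convolution: the coefficient of `f ⊠ g` at a word `w` of length `n ≥ 1` is
`∑_{π ∈ NC(n)} f_π(w) g_{Kr(π)}(w)`. -/
noncomputable def FormalSeries.boxedConv {ι : Type*} (f g : FormalSeries ι) : FormalSeries ι :=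
  ⟨fun w => if w = [] then 0 else
      ∑ π ∈ NC w.length, multExt f.1 w π * multExt g.1 w (kreweras π), if_pos rfl⟩

/-- The scalar-valued R-transform of the family `x`: the coefficient of `z_{i_1} ⋯ z_{i_n}`, `n ≥ 1`,
is the cumulant `k_n(x_{i_1}, …, x_{i_n})`. -/
noncomputable def rTransform {A ι : Type*} [Ring A] [Algebra ℂ A] (φ : A →ₗ[ℂ] ℂ) (x : ι → A) :
    FormalSeries ι :=
  ⟨fun w => if w = [] then 0 else scalarCumulant φ (w.map x), if_pos rfl⟩

/-! ### Moment-cumulant formula for indexed words -/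

/-! The three identities are statements of scalar free probability about two `φ`-free families, so
the point is that `{x_i}` and `{y_i}` are free in `(A, φ)` (`IsBFree.isFree`).

For this, let `m_1, …, m_n` lie in an algebra free from `B`. One wants their `B`-valued cumulant to
be the scalar `k_n(m_1, …, m_n)`. As `φ` need not be faithful on `B`, this is shown only modulo the
two-sided ideal `N = nullIdeal φ B` of those `b ∈ B` that vanish under `φ` between any two elements
of `B`. The induction carries coefficients: if `β_i ≡ c_i` mod `N`, then `C(β_1 m_1, …, β_n m_n) ≡
(∏ c_i) k_n(m_1, …, m_n)` mod `N` (`opCumulant_sub_mem_nullIdeal`). In the recursion for cumulants,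
the nested evaluations are scalars mod `N` by induction and come out as a product over blocks. For
the moment term, compatibility replaces `E` by `φ`, the `β_i` may be replaced by `c_i` because
freeness makes every word with a letter in `N` vanish (`IsFree.map_mul_null_mul`), and freeness then
gives `φ(b m_1 ⋯ m_n b') = φ(m_1 ⋯ m_n) φ(b b')`. With `β_i = 1`, a vanishing mixed `B`-valued
cumulant forces `k_n • 1 ∈ N`, and applying `φ` gives `k_n = 0`.

Given scalar freeness, (1) is the vanishing of mixed cumulants, and (2) follows by multilinearity.
For (3), the moment of `∏ x_{i_j} y_{i_j}` is a sum over noncrossing partitions of `2n` points that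
do not mix parities, that is, over noncrossing pairs `(π, σ)` compatible with each other
(`IsFree.map_prod_mul`). Grouping the pairs by the join `ρ = π ⊔ σ`, each block of `ρ` carries a
pair with join `⊤`, which forces `σ = Kr(π)` there; so the moment is the sum over `ρ` of products of
coefficients of the boxed convolution (`sum_compatPairs`). Since the moment-cumulant formula
determines cumulants, (3) follows. Equivalence relations replace `Finpartition`s in this part,
because restriction, gluing and joins are simpler for them. -/

theorem MixedCumulantsVanish.map_eq_zero {A M ι κ : Type*} [Zero M] {c : List A → M}
    {S : ι → Set A} (h : MixedCumulantsVanish c S) (l : List κ) (i : κ → ι) (a : κ → A)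
    (ha : ∀ j ∈ l, a j ∈ S (i j)) (hi : ∃ j ∈ l, ∃ k ∈ l, i j ≠ i k) : c (l.map a) = 0 := by
  have : l.map a = List.ofFn (fun j : Fin l.length => a (l.get j)) := by
    conv_lhs => rw [← List.ofFn_get l, List.map_ofFn]
    rfl
  rw [this]
  refine h _ (fun j => i (l.get j)) _ (fun j => ha _ (List.get_mem _ _)) ?_
  obtain ⟨j, hj, k, hk, hjk⟩ := hi
  obtain ⟨j', rfl⟩ := List.get_of_mem hj
  obtain ⟨k', rfl⟩ := List.get_of_mem hk
  exact ⟨j', k', hjk⟩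

theorem mem_NC {n : ℕ} {π : Finpartition (Finset.univ : Finset (Fin n))} :
    π ∈ NC n ↔ IsNoncrossing π := by
  simp [NC]

theorem sum_multExt_ofFn {α : Type*} {n : ℕ} (a : Fin n → α) (f : List α → ℂ) :
    ∑ π ∈ NC (List.ofFn a).length, multExt f (List.ofFn a) π =
      ∑ π ∈ NC n, ∏ V ∈ π.parts, f (V.sort.map a) := by
  -- The length of `List.ofFn a` is not definitionally `n`; with a variable list the equation can be
  -- substituted.
  have key : ∀ (l : List α) (h : l.length = n), (∀ i : Fin n, l.get (i.cast h.symm) = a i) →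
      ∑ π ∈ NC l.length, multExt f l π = ∑ π ∈ NC n, ∏ V ∈ π.parts, f (V.sort.map a) := by
    intro l h hl
    subst h
    have : l.get = a := funext hl
    subst this
    rfl
  exact key _ (List.length_ofFn) (by simp)

theorem moment_eq_sum_prod {A : Type*} [Ring A] [Algebra ℂ A] (φ : A →ₗ[ℂ] ℂ) {n : ℕ}
    (hn : n ≠ 0) (a : Fin n → A) :
    φ (List.ofFn a).prod =
      ∑ π ∈ NC n, ∏ V ∈ π.parts, scalarCumulant φ (V.sort.map a) := by
  rw [sum_multExt_scalarCumulant φ _ (by simpa using hn)]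
  exact sum_multExt_ofFn a _

theorem scalarCumulant_ofFn {A : Type*} [Ring A] [Algebra ℂ A] (φ : A →ₗ[ℂ] ℂ) {n : ℕ}
    (hn : n ≠ 0) (a : Fin n → A) :
    scalarCumulant φ (List.ofFn a) = φ (List.ofFn a).prod -
      ∑ π ∈ (NC n).filter (fun π => π.parts ≠ {Finset.univ}),
        ∏ V ∈ π.parts, scalarCumulant φ (V.sort.map a) := by
  rw [moment_eq_sum_prod φ hn, sum_NC_eq (Nat.pos_of_ne_zero hn) _ (scalarCumulant φ (List.ofFn a)),
    add_sub_cancel_right]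
  intro π hπ
  rw [hπ, Finset.prod_singleton, Fin.sort_univ, List.ofFn_eq_map]

theorem scalarCumulant_singleton {A : Type*} [Ring A] [Algebra ℂ A] (φ : A →ₗ[ℂ] ℂ) (a : A) :
    scalarCumulant φ [a] = φ a := by
  have := scalarCumulant_ofFn φ one_ne_zero (fun _ : Fin 1 => a)
  rw [Finset.filter_eq_empty_iff.2] at this
  · simpa using this
  · intro π _ h
    apply h
    have h1 : ∀ V ∈ π.parts, V = Finset.univ := by
      intro V hV
      obtain ⟨i, hi⟩ := π.nonempty_of_mem_parts hV
      ext j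
      exact iff_of_true (Subsingleton.elim i j ▸ hi) (Finset.mem_univ j)
    refine Finset.eq_singleton_iff_unique_mem.2 ⟨?_, h1⟩
    have := π.part_mem.2 (Finset.mem_univ 0)
    rwa [h1 _ this] at this

/-! ### Centred alternating words -/

/-- Among pairs `i < j` in a common block take one with `j - i` minimal. If `j ≠ i + 1`, the block
of `i + 1` is not a singleton, and noncrossing traps it strictly between `i` and `j`, where it
contains a closer pair. -/
theorem IsNoncrossing.exists_singleton_or_adjacent {n : ℕ}
    {π : Finpartition (Finset.univ : Finset (Fin n))} (hπ : IsNoncrossing π) (hn : n ≠ 0) :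
    (∃ i, {i} ∈ π.parts) ∨
      ∃ V ∈ π.parts, ∃ (i : ℕ) (h : i + 1 < n), ⟨i, by omega⟩ ∈ V ∧ ⟨i + 1, h⟩ ∈ V := by
  by_contra! hcon
  obtain ⟨h1, h2⟩ := hcon
  have hex : ∃ d : ℕ, ∃ V ∈ π.parts, ∃ i ∈ V, ∃ j ∈ V, i < j ∧ (j : ℕ) - i = d := by
    let i0 : Fin n := ⟨0, by omega⟩
    have hm := π.part_mem.2 (Finset.mem_univ i0)
    have hi := π.mem_part (Finset.mem_univ i0)
    have : ∃ j ∈ π.part i0, j ≠ i0 := by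
      by_contra! h
      exact h1 i0 ((Finset.eq_singleton_iff_unique_mem.2 ⟨hi, h⟩) ▸ hm)
    obtain ⟨j, hj, hj0⟩ := this
    exact ⟨_, _, hm, i0, hi, j, hj, by
      rw [Fin.lt_def]; exact Nat.pos_of_ne_zero fun h => hj0 (Fin.ext h), rfl⟩
  classical
  obtain ⟨V, hV, i, hi, j, hj, hij, hd⟩ := Nat.find_spec hex
  have hmin : ∀ V ∈ π.parts, ∀ i ∈ V, ∀ j ∈ V, i < j → Nat.find hex ≤ (j : ℕ) - i :=
    fun V hV i hi j hj hij => Nat.find_min' hex ⟨V, hV, i, hi, j, hj, hij, rfl⟩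
  rw [← hd] at hmin
  have hijn : (i : ℕ) < j := hij
  by_cases hadj : (i : ℕ) + 1 = j
  · refine h2 V hV i (by omega) hi ?_
    convert hj
  · let m : Fin n := ⟨i + 1, by omega⟩
    have him : i < m := by rw [Fin.lt_def]; simp [m]
    have hmj : m < j := by rw [Fin.lt_def]; simp only [m]; omega
    have hm := π.part_mem.2 (Finset.mem_univ m)
    have hmm := π.mem_part (Finset.mem_univ m)
    have hne : V ≠ π.part m := by
      intro h
      have := hmin V hV i hi m (h ▸ hmm) him
      simp only [m] at this
      omega
    have : ∃ k ∈ π.part m, k ≠ m := by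
      by_contra! h
      exact h1 m ((Finset.eq_singleton_iff_unique_mem.2 ⟨hmm, h⟩) ▸ hm)
    obtain ⟨k, hk, hkm⟩ := this
    have hki : k ≠ i := fun h => hne (π.eq_of_mem_parts hV hm hi (h ▸ hk))
    have hkj : k ≠ j := fun h => hne (π.eq_of_mem_parts hV hm hj (h ▸ hk))
    have hik : i < k := by
      by_contra! h
      exact hne (hπ _ hm V hV k i m j (lt_of_le_of_ne h hki) him hmj hk hmm hi hj).symm
    have hkj' : k < j := by
      by_contra! h
      exact hne (hπ V hV _ hm i m j k him hmj (lt_of_le_of_ne h hkj.symm) hi hj hmm hk)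
    have hmk : m < k := by
      refine lt_of_le_of_ne ?_ hkm.symm
      rw [Fin.le_def]; rw [Fin.lt_def] at hik; simp only [m]; omega
    have := hmin _ hm m hmm k hk hmk
    rw [Fin.lt_def] at hkj' hmk him
    omega

/-- In a family of free subsets, alternating products of centred elements of the generated
subalgebras are centred. -/
theorem IsFree.map_prod_eq_zero {A ι : Type*} [Ring A] [Algebra ℂ A] {φ : A →ₗ[ℂ] ℂ}
    {X : ι → Set A} (h : IsFree φ X) (l : List (ι × A)) (hl : l ≠ [])
    (hmem : ∀ p ∈ l, p.2 ∈ Algebra.adjoin ℂ (X p.1)) (hcent : ∀ p ∈ l, φ p.2 = 0)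
    (halt : l.IsChain (fun p q => p.1 ≠ q.1)) : φ (l.map Prod.snd).prod = 0 := by
  have hn : l.length ≠ 0 := by simpa using hl
  have : l.map Prod.snd = List.ofFn (fun j : Fin l.length => (l.get j).2) := by
    conv_lhs => rw [← List.ofFn_get l, List.map_ofFn]
    rfl
  rw [this, moment_eq_sum_prod φ hn]
  refine Finset.sum_eq_zero fun π hπ => ?_
  have hπ' := mem_NC.1 hπ
  -- A singleton block contributes `φ` of a centred letter; a block with two neighbours contributes
  -- a mixed cumulant.
  rcases hπ'.exists_singleton_or_adjacent hn with ⟨i, hi⟩ | ⟨V, hV, i, hi, h1, h2⟩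
  · refine Finset.prod_eq_zero hi ?_
    rw [Finset.sort_singleton]
    simp only [List.map_cons, List.map_nil, scalarCumulant_singleton]
    exact hcent _ (List.get_mem _ _)
  · refine Finset.prod_eq_zero hV ?_
    refine h.map_eq_zero _ (fun j => (l.get j).1) _ (fun j _ => hmem _ (List.get_mem _ _)) ?_
    refine ⟨_, (Finset.mem_sort _).2 h1, _, (Finset.mem_sort _).2 h2, ?_⟩
    exact List.isChain_iff_getElem.1 halt i hi

/-! ### The null ideal of a functional on a subalgebra -/

/-- The elements `n` of `B` with `φ (b n b') = 0` for all `b, b' ∈ B`. -/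
def nullIdeal {A : Type*} [Ring A] [Algebra ℂ A] (φ : A →ₗ[ℂ] ℂ) (B : Subalgebra ℂ A) :
    Submodule ℂ A where
  carrier := {n | n ∈ B ∧ ∀ b ∈ B, ∀ b' ∈ B, φ (b * n * b') = 0}
  add_mem' := by
    rintro m n ⟨hm, hm'⟩ ⟨hn, hn'⟩
    refine ⟨add_mem hm hn, fun b hb b' hb' => ?_⟩
    rw [mul_add, add_mul, map_add, hm' b hb b' hb', hn' b hb b' hb', add_zero]
  zero_mem' := ⟨zero_mem _, by simp⟩
  smul_mem' := by
    rintro c n ⟨hn, hn'⟩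
    refine ⟨B.smul_mem hn c, fun b hb b' hb' => ?_⟩
    rw [mul_smul_comm, smul_mul_assoc, map_smul, hn' b hb b' hb', smul_zero]

section nullIdeal

variable {A : Type*} [Ring A] [Algebra ℂ A] {φ : A →ₗ[ℂ] ℂ} {B : Subalgebra ℂ A}

theorem mul_mem_nullIdeal_left {b n : A} (hb : b ∈ B) (hn : n ∈ nullIdeal φ B) :
    b * n ∈ nullIdeal φ B :=
  ⟨mul_mem hb hn.1, fun c hc c' hc' => by
    rw [← mul_assoc]; exact hn.2 _ (mul_mem hc hb) _ hc'⟩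

theorem mul_mem_nullIdeal_right {b n : A} (hb : b ∈ B) (hn : n ∈ nullIdeal φ B) :
    n * b ∈ nullIdeal φ B :=
  ⟨mul_mem hn.1 hb, fun c hc c' hc' => by
    rw [← mul_assoc, mul_assoc]; exact hn.2 _ hc _ (mul_mem hb hc')⟩

theorem map_eq_zero_of_mem_nullIdeal {n : A} (hn : n ∈ nullIdeal φ B) : φ n = 0 := by
  simpa using hn.2 1 (one_mem _) 1 (one_mem _)

end nullIdeal

/-- A word in letters of free subalgebras vanishes under `φ` if one of the letters lies in the null
ideal of its subalgebra. -/
theorem IsFree.map_mul_null_mul {A ι : Type*} [Ring A] [Algebra ℂ A] {φ : A →ₗ[ℂ] ℂ}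
    (hφ : φ 1 = 1) {X : ι → Set A} (h : IsFree φ X) (i : ι) (l₁ l₂ : List (ι × A))
    (h₁ : ∀ p ∈ l₁, p.2 ∈ Algebra.adjoin ℂ (X p.1)) (h₂ : ∀ p ∈ l₂, p.2 ∈ Algebra.adjoin ℂ (X p.1))
    (n : A) (hn : n ∈ nullIdeal φ (Algebra.adjoin ℂ (X i))) :
    φ ((l₁.map Prod.snd).prod * n * (l₂.map Prod.snd).prod) = 0 := by
  induction hk : l₁.length + l₂.length using Nat.strong_induction_on generalizing l₁ l₂ n with
  | _ k ih =>
  let c : ι × A → ι × A := fun p => (p.1, p.2 - φ p.2 • 1)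
  have hc : ∀ p : ι × A, p.2 ∈ Algebra.adjoin ℂ (X p.1) → (c p).2 ∈ Algebra.adjoin ℂ (X (c p).1) :=
    fun p hp => sub_mem hp (Subalgebra.smul_mem _ (one_mem _) _)
  have hcφ : ∀ p, φ (c p).2 = 0 := by
    intro p
    simp [c, hφ]
  have hcl : ∀ l : List (ι × A), (∀ p ∈ l, p.2 ∈ Algebra.adjoin ℂ (X p.1)) →
      ∀ p ∈ l.map c, p.2 ∈ Algebra.adjoin ℂ (X p.1) := by
    intro l hl p hp
    obtain ⟨q, hq, rfl⟩ := List.mem_map.1 hp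
    exact hc q (hl q hq)
  have hsplit : ∀ p : ι × A, p.2 = (c p).2 + φ p.2 • 1 := fun p => by simp [c]
  -- Letters are centred one at a time, with `pre` the part already treated: the correction `φ p.2 •
  -- 1` deletes a letter, so it vanishes by the induction on `k`.
  have hleft : ∀ t pre : List (ι × A), (∀ p ∈ pre, p.2 ∈ Algebra.adjoin ℂ (X p.1)) →
      (∀ p ∈ t, p.2 ∈ Algebra.adjoin ℂ (X p.1)) → pre.length + t.length + l₂.length = k →
      φ (((pre ++ t).map Prod.snd).prod * n * (l₂.map Prod.snd).prod) =
        φ (((pre ++ t.map c).map Prod.snd).prod * n * (l₂.map Prod.snd).prod) := by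
    intro t
    induction t with
    | nil => intros; rfl
    | cons p t iht =>
      intro pre hpre ht hlen
      have hp := ht p (by simp)
      have ht' : ∀ q ∈ t, q.2 ∈ Algebra.adjoin ℂ (X q.1) := fun q hq => ht q (by simp [hq])
      have h1 := iht (pre ++ [c p]) (by
        intro q hq
        rcases List.mem_append.1 hq with hq | hq
        · exact hpre q hq
        · rw [List.mem_singleton.1 hq]; exact hc p hp) ht' (by simp at hlen ⊢; omega)
      have h0 := ih (k - 1) (by simp at hlen; omega) (pre ++ t) l₂ (by
        intro q hq
        rcases List.mem_append.1 hq with hq | hq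
        · exact hpre q hq
        · exact ht' q hq) h₂ n hn (by simp at hlen ⊢; omega)
      simp only [List.map_append, List.map_cons, List.prod_append, List.prod_cons,
        List.append_assoc, List.singleton_append] at h1 h0 ⊢
      rw [← h1, hsplit p]
      simp only [add_mul, mul_add, smul_mul_assoc, mul_smul_comm, one_mul, map_add, map_smul, h0]
      simp [c]
  have hright : ∀ t pre : List (ι × A), (∀ p ∈ pre, p.2 ∈ Algebra.adjoin ℂ (X p.1)) →
      (∀ p ∈ t, p.2 ∈ Algebra.adjoin ℂ (X p.1)) → ∀ l : List (ι × A),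
      (∀ p ∈ l, p.2 ∈ Algebra.adjoin ℂ (X p.1)) → l.length + (pre.length + t.length) = k →
      φ ((l.map Prod.snd).prod * n * ((pre ++ t).map Prod.snd).prod) =
        φ ((l.map Prod.snd).prod * n * ((pre ++ t.map c).map Prod.snd).prod) := by
    intro t
    induction t with
    | nil => intros; rfl
    | cons p t iht =>
      intro pre hpre ht l hl hlen
      have hp := ht p (by simp)
      have ht' : ∀ q ∈ t, q.2 ∈ Algebra.adjoin ℂ (X q.1) := fun q hq => ht q (by simp [hq])
      have h1 := iht (pre ++ [c p]) (by
        intro q hq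
        rcases List.mem_append.1 hq with hq | hq
        · exact hpre q hq
        · rw [List.mem_singleton.1 hq]; exact hc p hp) ht' l hl (by simp at hlen ⊢; omega)
      have h0 := ih (k - 1) (by simp at hlen; omega) l (pre ++ t) hl (by
        intro q hq
        rcases List.mem_append.1 hq with hq | hq
        · exact hpre q hq
        · exact ht' q hq) n hn (by simp at hlen ⊢; omega)
      simp only [List.map_append, List.map_cons, List.prod_append, List.prod_cons,
        List.append_assoc, List.singleton_append] at h1 h0 ⊢
      rw [← h1, hsplit p]
      simp only [add_mul, mul_add, smul_mul_assoc, mul_smul_comm, one_mul, map_add, map_smul, h0]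
      simp [c]
  have e1 := hleft l₁ [] (by simp) h₁ (by simpa using hk)
  have e2 := hright l₂ [] (by simp) h₂ (l₁.map c) (hcl _ h₁) (by simpa using hk)
  simp only [List.nil_append] at e1 e2
  rw [e1, e2]
  have hk' : (l₁.map c).length + (l₂.map c).length = k := by simpa using hk
  have hz₁ : ∀ p ∈ l₁.map c, φ p.2 = 0 := by
    intro p hp
    obtain ⟨q, hq, rfl⟩ := List.mem_map.1 hp
    exact hcφ q
  have hz₂ : ∀ p ∈ l₂.map c, φ p.2 = 0 := by
    intro p hp
    obtain ⟨q, hq, rfl⟩ := List.mem_map.1 hp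
    exact hcφ q
  have hm₁ := hcl _ h₁
  have hm₂ := hcl _ h₂
  generalize l₁.map c = u₁ at hk' hz₁ hm₁
  generalize l₂.map c = u₂ at hk' hz₂ hm₂
  -- If the centred word alternates, freeness applies, `n` being centred as well. Otherwise two
  -- neighbours of equal index are multiplied and the word gets shorter; a letter absorbed by `n`
  -- leaves it in the ideal.
  by_cases hch : (u₁ ++ (i, n) :: u₂).IsChain (fun p q => p.1 ≠ q.1)
  · have := h.map_prod_eq_zero (u₁ ++ (i, n) :: u₂) (by simp) (by
      intro p hp
      rcases List.mem_append.1 hp with hp | hp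
      · exact hm₁ p hp
      · rcases List.mem_cons.1 hp with rfl | hp
        · exact hn.1
        · exact hm₂ p hp) (by
      intro p hp
      rcases List.mem_append.1 hp with hp | hp
      · exact hz₁ p hp
      · rcases List.mem_cons.1 hp with rfl | hp
        · exact map_eq_zero_of_mem_nullIdeal hn
        · exact hz₂ p hp) hch
    simpa [mul_assoc] using this
  · have hmerge : ∀ u v : List (ι × A), ∀ p q : ι × A,
        (∀ r ∈ u ++ p :: q :: v, r.2 ∈ Algebra.adjoin ℂ (X r.1)) → p.1 = q.1 →
        ∀ r ∈ u ++ (p.1, p.2 * q.2) :: v, r.2 ∈ Algebra.adjoin ℂ (X r.1) := by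
      intro u v p q hr hpq r hr'
      rcases List.mem_append.1 hr' with h' | h'
      · exact hr r (by simp [h'])
      · rcases List.mem_cons.1 h' with rfl | h'
        · exact mul_mem (hr p (by simp)) (hpq ▸ hr q (by simp))
        · exact hr r (by simp [h'])
    rw [List.isChain_split, List.isChain_append] at hch
    by_cases c1 : u₁.IsChain (fun p q => p.1 ≠ q.1)
    · by_cases c2 : u₂.IsChain (fun p q => p.1 ≠ q.1)
      · rcases List.eq_nil_or_concat u₁ with rfl | ⟨v, p, rfl⟩
        · rcases u₂ with - | ⟨p, v⟩
          · simp at hch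
          · have hp : i = p.1 := by simpa [c2] using hch
            have := ih (k - 1) (by simp at hk'; omega) [] v (by simp)
              (fun q hq => hm₂ q (by simp [hq])) (n * p.2)
              (mul_mem_nullIdeal_right (hp ▸ hm₂ p (by simp)) hn) (by simp at hk' ⊢; omega)
            simpa [mul_assoc] using this
        · by_cases hp : p.1 = i
          · have := ih (k - 1) (by simp at hk'; omega) v u₂ (fun q hq => hm₁ q (by simp [hq])) hm₂
              (p.2 * n) (mul_mem_nullIdeal_left (hp ▸ hm₁ p (by simp)) hn)
              (by simp at hk' ⊢; omega)
            simpa [mul_assoc] using this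
          · rcases u₂ with - | ⟨q, w⟩
            · simp [hp] at hch
              exact absurd c1 (by simpa using hch)
            · have hq : i = q.1 := by
                by_contra hq
                apply hch
                simp [hp, hq, c2]
                simpa using c1
              have := ih (k - 1) (by simp at hk'; omega) (v ++ [p]) w (by simpa using hm₁)
                (fun r hr => hm₂ r (by simp [hr])) (n * q.2)
                (mul_mem_nullIdeal_right (hq ▸ hm₂ q (by simp)) hn) (by simp at hk' ⊢; omega)
              simpa [mul_assoc] using this
      · rw [List.isChain_iff_forall_rel_of_append_cons_cons] at c2
        push Not at c2
        obtain ⟨p, q, u, v, rfl, hpq⟩ := c2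
        have := ih (k - 1) (by simp at hk'; omega) u₁ (u ++ (p.1, p.2 * q.2) :: v) hm₁
          (hmerge u v p q hm₂ hpq) n hn (by simp at hk' ⊢; omega)
        simpa [mul_assoc] using this
    · rw [List.isChain_iff_forall_rel_of_append_cons_cons] at c1
      push Not at c1
      obtain ⟨p, q, u, v, rfl, hpq⟩ := c1
      have := ih (k - 1) (by simp at hk'; omega) (u ++ (p.1, p.2 * q.2) :: v) u₂
        (hmerge u v p q hm₁ hpq) hm₂ n hn (by simp at hk' ⊢; omega)
      simpa [mul_assoc] using this

theorem IsFree.map_mul_null_mul_of_mem_closure {A ι : Type*} [Ring A] [Algebra ℂ A] {φ : A →ₗ[ℂ] ℂ}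
    (hφ : φ 1 = 1) {X : ι → Set A} (h : IsFree φ X) (i : ι) {n p q : A}
    (hn : n ∈ nullIdeal φ (Algebra.adjoin ℂ (X i)))
    (hp : p ∈ Submonoid.closure (⋃ i, (Algebra.adjoin ℂ (X i) : Set A)))
    (hq : q ∈ Submonoid.closure (⋃ i, (Algebra.adjoin ℂ (X i) : Set A))) :
    φ (p * n * q) = 0 := by
  have key : ∀ p ∈ Submonoid.closure (⋃ i, (Algebra.adjoin ℂ (X i) : Set A)),
      ∃ l : List (ι × A), (∀ p ∈ l, p.2 ∈ Algebra.adjoin ℂ (X p.1)) ∧ (l.map Prod.snd).prod = p := by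
    intro p hp
    induction hp using Submonoid.closure_induction with
    | mem x hx =>
      obtain ⟨j, hj⟩ := Set.mem_iUnion.1 hx
      exact ⟨[(j, x)], by simpa using hj, by simp⟩
    | one => exact ⟨[], by simp, by simp⟩
    | mul x y _ _ hx hy =>
      obtain ⟨l, hl, rfl⟩ := hx
      obtain ⟨l', hl', rfl⟩ := hy
      refine ⟨l ++ l', fun p hp => ?_, by simp⟩
      rcases List.mem_append.1 hp with hp | hp
      · exact hl p hp
      · exact hl' p hp
  obtain ⟨l₁, h₁, rfl⟩ := key p hp
  obtain ⟨l₂, h₂, rfl⟩ := key q hq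
  exact h.map_mul_null_mul hφ i l₁ l₂ h₁ h₂ n hn

/-- Writing each letter as centred part plus scalar, every alternating word in the centred parts
vanishes, so only the scalar part of `m` survives. -/
theorem IsFree.map_mul_mul {A ι : Type*} [Ring A] [Algebra ℂ A] {φ : A →ₗ[ℂ] ℂ}
    (hφ : φ 1 = 1) {X : ι → Set A} (h : IsFree φ X) {i j : ι} (hij : i ≠ j) {b m b' : A}
    (hb : b ∈ Algebra.adjoin ℂ (X i)) (hm : m ∈ Algebra.adjoin ℂ (X j))
    (hb' : b' ∈ Algebra.adjoin ℂ (X i)) : φ (b * m * b') = φ m * φ (b * b') := by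
  have hc : ∀ (k : ι) (a : A), a ∈ Algebra.adjoin ℂ (X k) →
      a - φ a • 1 ∈ Algebra.adjoin ℂ (X k) ∧ φ (a - φ a • 1) = 0 ∧ a = (a - φ a • 1) + φ a • 1 :=
    fun k a ha => ⟨sub_mem ha (Subalgebra.smul_mem _ (one_mem _) _), by simp [hφ], by simp⟩
  obtain ⟨hb1, hb2, hb3⟩ := hc i b hb
  obtain ⟨hm1, hm2, hm3⟩ := hc j m hm
  obtain ⟨hd1, hd2, hd3⟩ := hc i b' hb'
  generalize b - φ b • 1 = b0 at hb1 hb2 hb3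
  generalize b' - φ b' • 1 = d0 at hd1 hd2 hd3
  generalize m - φ m • 1 = m0 at hm1 hm2 hm3
  have e1 := h.map_prod_eq_zero [(i, b0), (j, m0), (i, d0)] (by simp) (by simp [hb1, hm1, hd1])
    (by simp [hb2, hm2, hd2]) (by simp [hij, hij.symm])
  have e2 := h.map_prod_eq_zero [(i, b0), (j, m0)] (by simp) (by simp [hb1, hm1])
    (by simp [hb2, hm2]) (by simp [hij])
  have e3 := h.map_prod_eq_zero [(j, m0), (i, d0)] (by simp) (by simp [hm1, hd1])
    (by simp [hm2, hd2]) (by simp [hij.symm])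
  simp only [List.map_cons, List.map_nil, List.prod_cons, List.prod_nil, mul_one] at e1 e2 e3
  have e4 : φ (b * m0 * b') = 0 := by
    rw [hb3, hd3]
    simp only [add_mul, mul_add, smul_mul_assoc, mul_smul_comm, one_mul, mul_one, map_add, map_smul,
      e2, e3, hm2, mul_assoc, e1]
    simp
  conv_lhs => rw [hm3]
  simp only [add_mul, mul_add, smul_mul_assoc, mul_smul_comm, mul_one, map_add, map_smul, e4]
  simp

/-! ### Block structure of nested evaluations -/

section blocks

variable {n : ℕ} {π : Finpartition (Finset.univ : Finset (Fin n))}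

/-- `S` is a union of blocks of `π`. -/
def IsBlockUnion (π : Finpartition (Finset.univ : Finset (Fin n))) (S : Finset (Fin n)) : Prop :=
  ∀ V ∈ π.parts, ∀ a ∈ V, a ∈ S → V ⊆ S

/-- The elements of `S` strictly between `w` and its predecessor in `V`. -/
abbrev gapBefore (V S : Finset (Fin n)) (w : Fin n) : Finset (Fin n) :=
  S.filter (fun u => u < w ∧ ∀ v ∈ V, v < w → v < u)

/-- The elements of `S` after the last element of `V`. -/
abbrev gapAfter (V S : Finset (Fin n)) : Finset (Fin n) :=
  S.filter (fun u => ∀ v ∈ V, v < u)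

/-- A block other than `V` that leaves the gap must pass over a point of `V`. Since `s ∈ V` lies to
the left of all of `S`, this gives a crossing with `V`. -/
theorem IsBlockUnion.gapBefore (hπ : IsNoncrossing π) {S V : Finset (Fin n)}
    (hS : IsBlockUnion π S) (hV : V ∈ π.parts) {s : Fin n} (hsV : s ∈ V) (hs : ∀ u ∈ S, s ≤ u)
    {w : Fin n} (hw : w ∈ V) : IsBlockUnion π (gapBefore V S w) := by
  intro W hW a haW ha b hb
  obtain ⟨haS, haw, hav⟩ := Finset.mem_filter.1 ha
  have hbS := hS W hW a haW haS hb
  have hVW : V ≠ W := by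
    rintro rfl
    exact lt_irrefl _ (hav a haW haw)
  have hbV : b ∉ V := fun h => hVW (π.eq_of_mem_parts hV hW h hb)
  have hsw : s < w := lt_of_le_of_lt (hs a haS) haw
  have hsa := hav s hsV hsw
  have hsb : s < b := lt_of_le_of_ne (hs b hbS) (fun h => hbV (h ▸ hsV))
  refine Finset.mem_filter.2 ⟨hbS, ?_, fun v hv hvw => ?_⟩
  · by_contra! hwb
    have hwb' : w < b := lt_of_le_of_ne hwb (fun h => hbV (h ▸ hw))
    exact hVW (hπ V hV W hW s a w b hsa haw hwb' hsV hw haW hb)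
  · by_contra! hbv
    have hbv' : b < v := lt_of_le_of_ne hbv (fun h => hbV (h ▸ hv))
    exact hVW (hπ V hV W hW s b v a hsb hbv' (hav v hv hvw) hsV hv hb haW)

theorem IsBlockUnion.gapAfter (hπ : IsNoncrossing π) {S V : Finset (Fin n)}
    (hS : IsBlockUnion π S) (hV : V ∈ π.parts) {s : Fin n} (hsV : s ∈ V) (hs : ∀ u ∈ S, s ≤ u) :
    IsBlockUnion π (gapAfter V S) := by
  intro W hW a haW ha b hb
  obtain ⟨haS, hav⟩ := Finset.mem_filter.1 ha
  have hbS := hS W hW a haW haS hb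
  have hVW : V ≠ W := by
    rintro rfl
    exact lt_irrefl _ (hav a haW)
  have hbV : b ∉ V := fun h => hVW (π.eq_of_mem_parts hV hW h hb)
  have hsb : s < b := lt_of_le_of_ne (hs b hbS) (fun h => hbV (h ▸ hsV))
  refine Finset.mem_filter.2 ⟨hbS, fun v hv => ?_⟩
  by_contra! hbv
  have hbv' : b < v := lt_of_le_of_ne hbv (fun h => hbV (h ▸ hv))
  exact hVW (hπ V hV W hW s b v a hsb hbv' (hav v hv) hsV hv hb haW)

/-- This mirrors the recursion of `nestedEval` for scalars: a noncrossing block inside `S` is `V`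
itself or lies in exactly one gap of `V`. -/
theorem prod_blocks_eq (hπ : IsNoncrossing π) {S V : Finset (Fin n)}
    (hS : IsBlockUnion π S) (hV : V ∈ π.parts) {s : Fin n} (hsV : s ∈ V) (hsS : s ∈ S)
    (hs : ∀ u ∈ S, s ≤ u) (g : Finset (Fin n) → ℂ) :
    ∏ W ∈ π.parts with W ⊆ S, g W =
      (∏ w ∈ V, ∏ W ∈ π.parts with W ⊆ gapBefore V S w, g W) * g V *
        ∏ W ∈ π.parts with W ⊆ gapAfter V S, g W := by
  classical
  have hne : ∀ W ∈ π.parts, ∃ a, a ∈ W := fun W hW => π.nonempty_of_mem_parts hW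
  have hset : π.parts.filter (· ⊆ S) =
      (V.biUnion fun w => π.parts.filter (· ⊆ gapBefore V S w)) ∪ ({V} ∪
        π.parts.filter (· ⊆ gapAfter V S)) := by
    ext W
    simp only [Finset.mem_filter, Finset.mem_union, Finset.mem_biUnion, Finset.mem_singleton]
    constructor
    · rintro ⟨hW, hWS⟩
      by_cases hVW : W = V
      · exact Or.inr (Or.inl hVW)
      obtain ⟨a, ha⟩ := hne W hW
      have haV : a ∉ V := fun h => hVW (π.eq_of_mem_parts hW hV ha h)
      by_cases haf : ∀ v ∈ V, v < a
      · exact Or.inr (Or.inr ⟨hW, hS.gapAfter hπ hV hsV hs W hW a ha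
          (Finset.mem_filter.2 ⟨hWS ha, haf⟩)⟩)
      · push Not at haf
        obtain ⟨v, hv, hav⟩ := haf
        -- The gap containing `a` is the one before the least element of `V` above `a`.
        have hne' : (V.filter (a ≤ ·)).Nonempty := ⟨v, Finset.mem_filter.2 ⟨hv, hav⟩⟩
        have hw := Finset.mem_filter.1 (Finset.min'_mem _ hne')
        have haw := lt_of_le_of_ne hw.2 (fun h => haV (h ▸ hw.1))
        refine Or.inl ⟨_, hw.1, hW, hS.gapBefore hπ hV hsV hs hw.1 W hW a ha
          (Finset.mem_filter.2 ⟨hWS ha, haw, fun u hu huw => ?_⟩)⟩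
        by_contra! hau
        exact absurd (Finset.min'_le _ u (Finset.mem_filter.2 ⟨hu, hau⟩)) (not_le.2 huw)
    · rintro (⟨w, hw, hW, h⟩ | rfl | ⟨hW, h⟩)
      · exact ⟨hW, h.trans (Finset.filter_subset _ _)⟩
      · exact ⟨hV, hS _ hV s hsV hsS⟩
      · exact ⟨hW, h.trans (Finset.filter_subset _ _)⟩
  have hVb : ∀ w, ∀ u ∈ gapBefore V S w, u ∉ V := fun w u hu huV =>
    lt_irrefl _ ((Finset.mem_filter.1 hu).2.2 u huV (Finset.mem_filter.1 hu).2.1)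
  have hVa : ∀ u ∈ gapAfter V S, u ∉ V := fun u hu huV =>
    lt_irrefl _ ((Finset.mem_filter.1 hu).2 u huV)
  rw [hset, Finset.prod_union, Finset.prod_biUnion, Finset.prod_union, Finset.prod_singleton,
    mul_assoc]
  · rw [Finset.disjoint_singleton_left, Finset.mem_filter]
    rintro ⟨-, h⟩
    exact hVa s (h hsV) hsV
  · intro v hv w hw hvw
    refine Finset.disjoint_left.2 fun W h1 h2 => hvw ?_
    obtain ⟨hW, h1⟩ := Finset.mem_filter.1 h1
    have h2 := (Finset.mem_filter.1 h2).2
    obtain ⟨a, ha⟩ := hne W hW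
    have h1 := (Finset.mem_filter.1 (h1 ha)).2
    have h2 := (Finset.mem_filter.1 (h2 ha)).2
    by_contra hvw
    rcases lt_or_gt_of_ne hvw with h | h
    · exact lt_asymm h1.1 (h2.2 v hv h)
    · exact lt_asymm h2.1 (h1.2 w hw h)
  · refine Finset.disjoint_left.2 fun W h1 h2 => ?_
    obtain ⟨w, hw, h1⟩ := Finset.mem_biUnion.1 h1
    obtain ⟨hW, h1⟩ := Finset.mem_filter.1 h1
    obtain ⟨a, ha⟩ := hne W hW
    rcases Finset.mem_union.1 h2 with h2 | h2
    · rw [Finset.mem_singleton.1 h2] at ha h1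
      exact hVb w a (h1 ha) ha
    · have h2 := (Finset.mem_filter.1 h2).2
      exact lt_asymm (Finset.mem_filter.1 (h1 ha)).2.1 ((Finset.mem_filter.1 (h2 ha)).2 w hw)

end blocks

/-- If `f` is scalar modulo the null ideal on the blocks of `π`, then so is its nested evaluation,
and the scalar is the product over the blocks. -/
theorem nestedEval_sub_mem_nullIdeal {A : Type*} [Ring A] [Algebra ℂ A] {φ : A →ₗ[ℂ] ℂ}
    {B : Subalgebra ℂ A} (f : List A → B) (l : List A)
    (π : Finpartition (Finset.univ : Finset (Fin l.length))) (hπ : IsNoncrossing π)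
    (g : Finset (Fin l.length) → ℂ)
    (hf : ∀ V ∈ π.parts, ∀ (γ : Fin l.length → A) (d : Fin l.length → ℂ),
      (∀ w ∈ V, γ w - d w • 1 ∈ nullIdeal φ B) →
      (f (V.sort.map fun w => γ w * l.get w) : A) - ((∏ w ∈ V, d w) * g V) • 1 ∈ nullIdeal φ B)
    (S : Finset (Fin l.length)) (hS : IsBlockUnion π S) :
    (nestedEval f l π S : A) - (∏ W ∈ π.parts with W ⊆ S, g W) • 1 ∈ nullIdeal φ B := by
  induction hc : S.card using Nat.strong_induction_on generalizing S with
  | _ m ih =>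
    rw [nestedEval]
    split_ifs with h
    · have hV := π.part_mem.2 (Finset.mem_univ (S.min' h))
      have hs := π.mem_part (Finset.mem_univ (S.min' h))
      generalize hVdef : π.part (S.min' h) = V at hV hs
      have hmin : ∀ u ∈ S, S.min' h ≤ u := fun u hu => S.min'_le u hu
      have hcard : ∀ (p : Fin l.length → Prop) [DecidablePred p], ¬ p (S.min' h) →
          (S.filter p).card < m := by
        intro p _ hp
        rw [← hc]
        exact Finset.card_lt_card (Finset.filter_ssubset.2 ⟨S.min' h, S.min'_mem h, hp⟩)
      have h1 := hf V hV (fun w => nestedEval f l π (gapBefore V S w))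
        (fun w => ∏ W ∈ π.parts with W ⊆ gapBefore V S w, g W) (fun w hw =>
          ih _ (hcard _ fun hu => lt_irrefl _ (hu.2 _ hs hu.1)) _
            (hS.gapBefore hπ hV hs hmin hw) rfl)
      have h2 := ih _ (hcard _ fun hu => lt_irrefl _ (hu _ hs)) _
        (hS.gapAfter hπ hV hs hmin) rfl
      rw [prod_blocks_eq hπ hS hV hs (S.min'_mem h) hmin g]
      generalize (∏ w ∈ V, ∏ W ∈ π.parts with W ⊆ gapBefore V S w, g W) * g V = c at h1 ⊢
      generalize ∏ W ∈ π.parts with W ⊆ gapAfter V S, g W = d at h2 ⊢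
      -- With `F` the value of `f` and `β` the evaluation after `V`: `F β - d c = F (β - d) + d (F -
      -- c)`.
      have h3 := add_mem (mul_mem_nullIdeal_left (SetLike.coe_mem
        (f (V.sort.map fun w => (nestedEval f l π (gapBefore V S w) : A) * l.get w))) h2)
        ((nullIdeal φ B).smul_mem d h1)
      convert h3 using 1
      simp only [Subalgebra.coe_mul, mul_sub, smul_sub, mul_smul_comm, mul_one, smul_smul]
      rw [mul_comm d c]
      abel
    · rw [Finset.not_nonempty_iff_eq_empty] at h
      rw [Finset.filter_eq_empty_iff.2]
      · simp
      · intro W hW hWS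
        obtain ⟨a, ha⟩ := π.nonempty_of_mem_parts hW
        have := hWS ha
        simp [h] at this

/-! ### Operator-valued cumulants of elements free from `B` -/

theorem list_prod_map_sort {α M : Type*} [LinearOrder α] [CommMonoid M] (V : Finset α)
    (h : α → M) : (V.sort.map h).prod = ∏ w ∈ V, h w := by
  rw [Finset.prod, ← Finset.sort_eq V (· ≤ ·), Multiset.map_coe, Multiset.prod_coe]

theorem prod_parts_prod {n : ℕ} (π : Finpartition (Finset.univ : Finset (Fin n)))
    (c : Fin n → ℂ) : ∏ V ∈ π.parts, ∏ w ∈ V, c w = ∏ w, c w := by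
  classical
  have := Finset.prod_biUnion (s := π.parts) (t := id) (f := c) π.disjoint
  rw [π.biUnion_parts] at this
  exact this.symm

section

variable {A : Type*} [Ring A] [Algebra ℂ A] {B : Subalgebra ℂ A} {φ : A →ₗ[ℂ] ℂ}

theorem mem_of_sub_smul_one_mem_nullIdeal {β : A} {c : ℂ} (h : β - c • 1 ∈ nullIdeal φ B) :
    β ∈ B := by
  have := add_mem h.1 (B.smul_mem (one_mem B) c)
  simpa using this

theorem mul_sub_smul_one_mem_nullIdeal {β γ : A} {c d : ℂ} (h : β - c • 1 ∈ nullIdeal φ B)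
    (h' : γ - d • 1 ∈ nullIdeal φ B) : β * γ - (c * d) • 1 ∈ nullIdeal φ B := by
  have := add_mem (mul_mem_nullIdeal_left (mem_of_sub_smul_one_mem_nullIdeal h) h')
    ((nullIdeal φ B).smul_mem d h)
  convert this using 1
  simp only [mul_sub, smul_sub, mul_smul_comm, mul_one, smul_smul]
  rw [mul_comm d c]
  abel

variable {M : Set A}

theorem iUnion_adjoin_pair :
    (⋃ i, (Algebra.adjoin ℂ ((![M, (B : Set A)] : Fin 2 → Set A) i) : Set A)) =
      (Algebra.adjoin ℂ M : Set A) ∪ B := by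
  ext x
  simp [Fin.exists_fin_two, Algebra.adjoin_eq]

/-- The coefficients are stripped from left to right, the treated letters moving into the prefix
`p`. Each exchange of `β i` for `c i` costs a word with a letter in the null ideal, which vanishes
under `φ`. -/
theorem map_word_congr (hφ : φ 1 = 1) (hfree : IsFree φ ![M, (B : Set A)]) {κ : Type*} (t : List κ)
    (β : κ → A) (c : κ → ℂ) (m : κ → A) (hm : ∀ i ∈ t, m i ∈ Algebra.adjoin ℂ M)
    (hβ : ∀ i ∈ t, β i - c i • 1 ∈ nullIdeal φ B) {p b' : A}
    (hp : p ∈ Submonoid.closure ((Algebra.adjoin ℂ M : Set A) ∪ B)) (hb' : b' ∈ B) :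
    φ (p * (t.map fun i => β i * m i).prod * b') = (t.map c).prod * φ (p * (t.map m).prod * b') := by
  induction t generalizing p with
  | nil => simp
  | cons i t ih =>
    have hmi : m i ∈ Submonoid.closure ((Algebra.adjoin ℂ M : Set A) ∪ B) :=
      Submonoid.subset_closure (Or.inl (hm i (by simp)))
    have ih' := ih (fun j hj => hm j (by simp [hj])) (fun j hj => hβ j (by simp [hj]))
      (mul_mem hp hmi)
    have hw : m i * (t.map fun i => β i * m i).prod * b' ∈
        Submonoid.closure ((Algebra.adjoin ℂ M : Set A) ∪ B) := by
      refine mul_mem (mul_mem hmi (Submonoid.list_prod_mem _ fun x hx => ?_))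
        (Submonoid.subset_closure (Or.inr hb'))
      obtain ⟨j, hj, rfl⟩ := List.mem_map.1 hx
      exact mul_mem (Submonoid.subset_closure (Or.inr
          (mem_of_sub_smul_one_mem_nullIdeal (hβ j (by simp [hj])))))
        (Submonoid.subset_closure (Or.inl (hm j (by simp [hj]))))
    have h0 := hfree.map_mul_null_mul_of_mem_closure hφ 1 (n := β i - c i • 1) (p := p)
      (q := m i * (t.map fun i => β i * m i).prod * b')
      (by simpa [Algebra.adjoin_eq] using hβ i (by simp)) (by rwa [iUnion_adjoin_pair]) (by rwa [iUnion_adjoin_pair])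
    have hsplit : p * ((i :: t).map fun i => β i * m i).prod * b' =
        p * (β i - c i • 1) * (m i * (t.map fun i => β i * m i).prod * b') +
          c i • (p * m i * (t.map fun i => β i * m i).prod * b') := by
      simp only [List.map_cons, List.prod_cons, mul_sub, sub_mul, mul_smul_comm, smul_mul_assoc,
        mul_one, mul_assoc]
      abel
    rw [hsplit, map_add, h0, map_smul, ih', zero_add]
    simp [mul_assoc]

theorem map_mul_coe_mul {E : A →ₗ[ℂ] B} (hE : IsBFunctional E) (hcomp : Compatible φ E) {b b' : A}
    (hb : b ∈ B) (hb' : b' ∈ B) (x : A) : φ (b * E x * b') = φ (b * x * b') := by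
  rw [hcomp (b * x * b'), hE.2 ⟨b, hb⟩ ⟨b', hb'⟩ x]
  rfl

/-- Modulo the null ideal of `B`, the `B`-valued cumulants of elements free from `B` are the scalar
cumulants. -/
theorem opCumulant_sub_mem_nullIdeal {E : A →ₗ[ℂ] B} (hE : IsBFunctional E)
    (hcomp : Compatible φ E) (hφ : φ 1 = 1) (hfree : IsFree φ ![M, (B : Set A)])
    {κ : Type} (t : List κ) (ht : t ≠ []) (β : κ → A) (c : κ → ℂ) (m : κ → A)
    (hm : ∀ i, m i ∈ Algebra.adjoin ℂ M)
    (hβ : ∀ i, β i - c i • 1 ∈ nullIdeal φ B) :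
    (opCumulant E (t.map fun i => β i * m i) : A) -
      ((t.map c).prod * scalarCumulant φ (t.map m)) • 1 ∈ nullIdeal φ B := by
  -- The index type changes in the induction: for a block `V` the letters are indexed by positions,
  -- with coefficient `γ w * β (r w)`, where `γ w` is the evaluation nested before position `w`.
  induction hn : t.length using Nat.strong_induction_on generalizing κ with
  | _ n ih =>
  generalize hl : (t.map fun i => β i * m i) = l
  have hlen : l.length = t.length := by rw [← hl, List.length_map]
  let r : Fin l.length → κ := fun w => t.get (w.cast hlen)
  have ht' : t = List.ofFn r := List.ext_getElem (by simp [hlen]) fun i _ _ => by simp [r]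
  have hr : ∀ u : κ → A, t.map u = List.ofFn (fun w => u (r w)) := fun u => by
    conv_lhs => rw [ht', List.map_ofFn]
    rfl
  have hrc : (t.map c).prod = ∏ w, c (r w) := by
    conv_lhs => rw [ht', List.map_ofFn, List.prod_ofFn]
    rfl
  have hget : ∀ w, l.get w = β (r w) * m (r w) := by
    subst hl
    intro w
    simp [r]
  have hl0 : l.length ≠ 0 := by rw [hlen]; simpa using ht
  rw [opCumulant, hr m, scalarCumulant_ofFn φ hl0, hrc]
  set C := ∏ w, c (r w) with hC
  -- Tested between `b` and `b'`: compatibility removes `E`, `map_word_congr` extracts `C`, and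
  -- freeness from `B` splits off `φ (b * b')`.
  have hmain : (E l.prod : A) - (C * φ (List.ofFn fun w => m (r w)).prod) • 1 ∈ nullIdeal φ B := by
    refine ⟨sub_mem (SetLike.coe_mem _) (B.smul_mem (one_mem B) _), fun b hb b' hb' => ?_⟩
    have hword := map_word_congr hφ hfree t β c m (fun i _ => hm i) (fun i _ => hβ i)
        (Submonoid.subset_closure (Or.inr hb)) hb'
    rw [hl, hr m, hrc] at hword
    rw [mul_sub, sub_mul, map_sub, map_mul_coe_mul hE hcomp hb hb', hword]
    have hprod : (List.ofFn fun w => m (r w)).prod ∈ Algebra.adjoin ℂ M := by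
      refine Subalgebra.list_prod_mem _ fun x hx => ?_
      obtain ⟨w, rfl⟩ := (List.mem_ofFn' _ _).1 hx
      exact hm _
    rw [hfree.map_mul_mul hφ (i := 1) (j := 0) (by decide) (by simpa [Algebra.adjoin_eq] using hb)
      (by simpa using hprod)
      (by simpa [Algebra.adjoin_eq] using hb')]
    simp only [mul_smul_comm, smul_mul_assoc, mul_one, map_smul, smul_eq_mul]
    ring
  have hpart : ∀ π ∈ (NC l.length).filter (fun π => π.parts ≠ {Finset.univ}),
      (nestedEval (fun l' => if l'.length < l.length then opCumulant E l' else 0) l π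
        Finset.univ : A) -
        (C * ∏ V ∈ π.parts, scalarCumulant φ (V.sort.map fun w => m (r w))) • 1 ∈
          nullIdeal φ B := by
    intro π hπ
    obtain ⟨hπ, hne⟩ := Finset.mem_filter.1 hπ
    have h1 := nestedEval_sub_mem_nullIdeal (φ := φ)
      (fun l' => if l'.length < l.length then opCumulant E l' else 0) l π (mem_NC.1 hπ)
      (fun V => (∏ w ∈ V, c (r w)) * scalarCumulant φ (V.sort.map fun w => m (r w))) ?_
      Finset.univ (fun V _ _ _ _ => Finset.subset_univ V)
    · rw [Finset.filter_true_of_mem (fun V _ => Finset.subset_univ V), Finset.prod_mul_distrib,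
        prod_parts_prod] at h1
      exact h1
    · intro V hV γ d hγ
      have hVl := part_card_lt π hne hV
      rw [if_pos (by simpa using hVl)]
      obtain ⟨a, ha⟩ := π.nonempty_of_mem_parts hV
      -- The congruence for `γ` is known on `V` only, while the induction hypothesis asks for it at
      -- every index; off `V` the scalar itself serves.
      let γ' : Fin l.length → A := fun w => if w ∈ V then γ w else d w • 1
      have hγ' : ∀ w, γ' w - d w • 1 ∈ nullIdeal φ B := by
        intro w
        by_cases hw : w ∈ V
        · simpa [γ', hw] using hγ w hw
        · simp [γ', hw]
      have h2 := ih V.card (by omega) V.sort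
        (List.ne_nil_of_mem ((Finset.mem_sort _).2 ha)) (fun w => γ' w * β (r w))
        (fun w => d w * c (r w)) (fun w => m (r w)) (fun w => hm _)
        (fun w => mul_sub_smul_one_mem_nullIdeal (hγ' w) (hβ _)) (by simp)
      rw [list_prod_map_sort, Finset.prod_mul_distrib, mul_assoc] at h2
      convert h2 using 3
      refine congrArg _ (List.map_congr_left fun w hw => ?_)
      rw [hget, mul_assoc]
      simp [γ', (Finset.mem_sort _).1 hw]
  have h3 := sub_mem hmain (Submodule.sum_mem _ hpart)
  convert h3 using 1
  simp only [Subalgebra.coe_sub, AddSubmonoidClass.coe_finsetSum, mul_sub, sub_smul,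
    Finset.sum_sub_distrib, Finset.mul_sum, Finset.sum_smul]
  abel

/-- Sets which are `B`-free, and together are free from `B`, are free. -/
theorem IsBFree.isFree {E : A →ₗ[ℂ] B} (hE : IsBFunctional E)
    (hcomp : Compatible φ E) (hφ : φ 1 = 1) {ι : Type*} {X : ι → Set A} (hX : IsBFree E X)
    (hXM : ∀ i, X i ⊆ M) (hfree : IsFree φ ![M, (B : Set A)]) : IsFree φ X := by
  intro n i a ha hi
  have hn : List.finRange n ≠ [] := by
    obtain ⟨j, -⟩ := hi
    exact List.ne_nil_of_mem (List.mem_finRange j)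
  have h1 := opCumulant_sub_mem_nullIdeal hE hcomp hφ hfree (List.finRange n) hn (fun _ => 1)
    (fun _ => 1) a (fun j => Algebra.adjoin_mono (hXM _) (ha j)) (by simp)
  have h2 := hX n i a (fun j => Algebra.adjoin_mono Set.subset_union_right (ha j)) hi
  simp only [one_mul, ← List.ofFn_eq_map, h2] at h1
  -- Here `h1` says that a multiple of `1`, the scalar being minus the cumulant, lies in the null
  -- ideal; `φ 1 = 1` finishes.
  have h3 := map_eq_zero_of_mem_nullIdeal h1
  simpa [hφ] using h3

end

/-! ### Multilinearity of scalar cumulants -/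

theorem sort_map_eq_ofFn {α β : Type*} [LinearOrder α] (V : Finset α) (u : α → β) :
    V.sort.map u = List.ofFn (fun j => u (V.orderEmbOfFin rfl j)) := by
  rw [← Finset.listMap_orderEmbOfFin_finRange V rfl, List.map_map, List.ofFn_eq_map]
  rfl

section

variable {A : Type*} [Ring A] [Algebra ℂ A] {φ : A →ₗ[ℂ] ℂ}

/-- The moment is linear in each argument, and in the term of any `π ≠ 1_n` only the block of `i`
involves `z`; that block is shorter than `n`, so induction applies. -/
theorem exists_linearMap_scalarCumulant_update (φ : A →ₗ[ℂ] ℂ) {n : ℕ} (a : Fin n → A)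
    (i : Fin n) :
    ∃ L : A →ₗ[ℂ] ℂ, ∀ z, scalarCumulant φ (List.ofFn (Function.update a i z)) = L z := by
  induction n using Nat.strong_induction_on with
  | _ n ih =>
  have hn : n ≠ 0 := fun h => by subst h; exact i.elim0
  have hV : ∀ π ∈ (NC n).filter (fun π => π.parts ≠ {Finset.univ}), ∃ L : A →ₗ[ℂ] ℂ, ∀ z,
      ∏ V ∈ π.parts, scalarCumulant φ (V.sort.map (Function.update a i z)) = L z := by
    intro π hπ
    have hmem := π.part_mem.2 (Finset.mem_univ i)
    have hi := π.mem_part (Finset.mem_univ i)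
    have hcard := part_card_lt π (Finset.mem_filter.1 hπ).2 hmem
    have hne : ∀ V ∈ π.parts.erase (π.part i), i ∉ V := fun V hV hiV =>
      (Finset.mem_erase.1 hV).1 (π.eq_of_mem_parts (Finset.mem_erase.1 hV).2 hmem hiV hi)
    generalize π.part i = V at *
    obtain ⟨j, hj⟩ : ∃ j, V.orderEmbOfFin rfl j = i := by
      have : i ∈ Set.range (V.orderEmbOfFin rfl) := by rwa [Finset.range_orderEmbOfFin]
      exact this
    obtain ⟨L, hL⟩ := ih V.card hcard (fun j => a (V.orderEmbOfFin rfl j)) j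
    refine ⟨(∏ W ∈ π.parts.erase V, scalarCumulant φ (W.sort.map a)) • L, fun z => ?_⟩
    rw [← Finset.prod_erase_mul _ _ hmem, LinearMap.smul_apply, smul_eq_mul, ← hL]
    congr 1
    · refine Finset.prod_congr rfl fun W hW => ?_
      congr 1
      refine List.map_congr_left fun w hw => Function.update_of_ne ?_ _ _
      rintro rfl
      exact hne W hW ((Finset.mem_sort _).1 hw)
    · rw [sort_map_eq_ofFn]
      congr 2
      have := Function.update_comp_eq_of_injective a (V.orderEmbOfFin rfl).injective j z
      rw [← hj]
      exact this
  choose! L hL using hV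
  refine ⟨φ ∘ₗ (MultilinearMap.mkPiAlgebraFin ℂ n A).toLinearMap a i -
    ∑ π ∈ (NC n).filter (fun π => π.parts ≠ {Finset.univ}), L π, fun z => ?_⟩
  rw [scalarCumulant_ofFn φ hn, Finset.sum_congr rfl fun π hπ => hL π hπ z]
  simp

/-- The `n`-th scalar cumulant as a multilinear map. -/
noncomputable def scalarCumulantMultilinear (φ : A →ₗ[ℂ] ℂ) (n : ℕ) :
    MultilinearMap ℂ (fun _ : Fin n => A) ℂ where
  toFun a := scalarCumulant φ (List.ofFn a)
  map_update_add' := by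
    intro inst a i p q
    obtain rfl : inst = instDecidableEqFin n := Subsingleton.elim _ _
    obtain ⟨L, hL⟩ := exists_linearMap_scalarCumulant_update φ a i
    rw [hL, hL, hL, map_add]
  map_update_smul' := by
    intro inst a i c p
    obtain rfl : inst = instDecidableEqFin n := Subsingleton.elim _ _
    obtain ⟨L, hL⟩ := exists_linearMap_scalarCumulant_update φ a i
    rw [hL, hL, map_smul]

/-! ### Additivity of the R-transform -/

theorem IsFree.scalarCumulant_map_eq_zero {X Y : Set A} (h : IsFree φ ![X, Y])
    {κ : Type*} (t : List κ) (p : κ → Prop) (a : κ → A) (hX : ∀ j ∈ t, p j → a j ∈ X)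
    (hY : ∀ j ∈ t, ¬ p j → a j ∈ Y) (hp : ∃ j ∈ t, p j) (hn : ∃ j ∈ t, ¬ p j) :
    scalarCumulant φ (t.map a) = 0 := by
  classical
  refine h.map_eq_zero t (fun j => if p j then 0 else 1) a (fun j hj => ?_) ?_
  · by_cases hpj : p j
    · simpa [hpj] using Algebra.subset_adjoin (hX j hj hpj)
    · simpa [hpj] using Algebra.subset_adjoin (hY j hj hpj)
  · obtain ⟨j, hj, hpj⟩ := hp
    obtain ⟨k, hk, hpk⟩ := hn
    exact ⟨j, hj, k, hk, by simp [hpj, hpk]⟩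

/-- Multilinear expansion runs over the set `T` of positions where `x` is chosen. Unless `T` is
everything or empty, the cumulant is mixed and vanishes; for a nonempty word these two cases are
distinct. -/
theorem IsFree.scalarCumulant_map_add {ι : Type*} {x y : ι → A}
    (h : IsFree φ ![Set.range x, Set.range y]) (w : List ι) (hw : w ≠ []) :
    scalarCumulant φ (w.map fun i => x i + y i) =
      scalarCumulant φ (w.map x) + scalarCumulant φ (w.map y) := by
  classical
  have hw0 : 0 < w.length := List.length_pos_of_ne_nil hw
  have hr : ∀ u : ι → A, w.map u = List.ofFn (fun j : Fin w.length => u (w.get j)) := fun u => by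
    conv_lhs => rw [← List.ofFn_get w, List.map_ofFn]
    rfl
  have h1 := (scalarCumulantMultilinear φ w.length).map_add_univ (fun j => x (w.get j))
    (fun j => y (w.get j))
  have hne : (Finset.univ : Finset (Fin w.length)) ≠ ∅ :=
    (Finset.univ_nonempty_iff.2 ⟨⟨0, hw0⟩⟩).ne_empty
  rw [← Finset.sum_subset (Finset.subset_univ {Finset.univ, ∅}), Finset.sum_pair hne] at h1
  · rw [hr, hr x, hr y]
    rw [Finset.piecewise_univ, Finset.piecewise_empty] at h1
    exact h1
  · intro T _ hT
    simp only [Finset.mem_insert, Finset.mem_singleton, not_or] at hT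
    change scalarCumulant φ (List.ofFn _) = 0
    rw [List.ofFn_eq_map]
    obtain ⟨j, hj⟩ := Finset.nonempty_iff_ne_empty.2 hT.2
    obtain ⟨k, hk⟩ : ∃ k, k ∉ T := by
      by_contra! hcon
      exact hT.1 (Finset.eq_univ_iff_forall.2 hcon)
    exact h.scalarCumulant_map_eq_zero _ (· ∈ T) _ (fun j _ hj => by simp [hj])
      (fun j _ hj => by simp [hj]) ⟨j, List.mem_finRange j, hj⟩ ⟨k, List.mem_finRange k, hk⟩

theorem IsFree.rTransform_add {ι : Type*} {x y : ι → A}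
    (h : IsFree φ ![Set.range x, Set.range y]) :
    rTransform φ (fun i => x i + y i) = rTransform φ x + rTransform φ y := by
  ext w
  by_cases hw : w = []
  · simp [rTransform, hw]
  · simpa [rTransform, hw] using h.scalarCumulant_map_add w hw

theorem FormalSeries.rename_map {ι κ : Type*} (e : ι ↪ κ) (f : FormalSeries ι) (w : List ι) :
    (FormalSeries.rename e f).1 (w.map e) = f.1 w :=
  (List.map_injective_iff.2 e.injective).extend_apply f.1 0 w

theorem FormalSeries.rename_eq_zero {ι κ : Type*} (e : ι ↪ κ) (f : FormalSeries ι) (w : List κ)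
    {k : κ} (hk : k ∈ w) (hke : k ∉ Set.range e) : (FormalSeries.rename e f).1 w = 0 := by
  refine Function.extend_apply' _ _ _ ?_
  rintro ⟨u, rfl⟩
  obtain ⟨i, -, rfl⟩ := List.mem_map.1 hk
  exact hke ⟨i, rfl⟩

theorem IsFree.rTransform_append {s t : ℕ} {x : Fin s → A} {y : Fin t → A}
    (h : IsFree φ ![Set.range x, Set.range y]) :
    rTransform φ (Fin.append x y) =
      FormalSeries.rename (Fin.castAddEmb t) (rTransform φ x) +
        FormalSeries.rename (Fin.natAddEmb s) (rTransform φ y) := by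
  ext w
  change (rTransform φ (Fin.append x y)).1 w = (FormalSeries.rename _ _).1 w +
    (FormalSeries.rename _ _).1 w
  by_cases hw : w = []
  · rw [hw, (rTransform φ _).2, (FormalSeries.rename _ _).2, (FormalSeries.rename _ _).2, add_zero]
  obtain ⟨k, hk⟩ := List.exists_mem_of_ne_nil w hw
  by_cases h1 : ∀ j ∈ w, j ∈ Set.range (Fin.castAddEmb t : Fin s ↪ Fin (s + t))
  · obtain ⟨u, rfl⟩ : w ∈ Set.range (List.map (Fin.castAddEmb t)) := by
      rw [Set.range_list_map]; exact h1
    rw [FormalSeries.rename_map, FormalSeries.rename_eq_zero (Fin.natAddEmb s) _ _ hk, add_zero]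
    · simp only [rTransform, List.map_map, List.map_eq_nil_iff]
      congr 3
      funext i
      simp
    · obtain ⟨i, rfl⟩ := h1 k hk
      rintro ⟨j, hj⟩
      have := congrArg Fin.val hj
      simp at this
      omega
  · push Not at h1
    obtain ⟨k, hk, hk1⟩ := h1
    rw [FormalSeries.rename_eq_zero (Fin.castAddEmb t) _ _ hk hk1, zero_add]
    have hR : ∀ j : Fin (s + t), j ∉ Set.range (Fin.castAddEmb t : Fin s ↪ Fin (s + t)) →
        j ∈ Set.range (Fin.natAddEmb s : Fin t ↪ Fin (s + t)) := by
      intro j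
      refine Fin.addCases (fun i hi => absurd ⟨i, rfl⟩ hi) (fun i _ => ⟨i, rfl⟩) j
    by_cases h2 : ∀ j ∈ w, j ∈ Set.range (Fin.natAddEmb s : Fin t ↪ Fin (s + t))
    · obtain ⟨u, rfl⟩ : w ∈ Set.range (List.map (Fin.natAddEmb s)) := by
        rw [Set.range_list_map]; exact h2
      rw [FormalSeries.rename_map]
      simp only [rTransform, List.map_map, List.map_eq_nil_iff]
      congr 3
      funext i
      simp
    · push Not at h2
      obtain ⟨l, hl, hl2⟩ := h2
      rw [FormalSeries.rename_eq_zero _ _ _ hl hl2]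
      have := h.scalarCumulant_map_eq_zero w
        (· ∈ Set.range (Fin.castAddEmb t : Fin s ↪ Fin (s + t))) (Fin.append x y)
        (by rintro j _ ⟨i, rfl⟩; simp) (fun j _ hj => by
          obtain ⟨i, rfl⟩ := hR j hj
          simp) ⟨l, hl, by by_contra hcon; exact hl2 (hR l hcon)⟩ ⟨k, hk, hk1⟩
      simpa [rTransform, hw] using this

end

/-! ### Noncrossing equivalence relations -/

section setoids

variable {n : ℕ}

/-- An equivalence relation is noncrossing if its classes do not cross. -/
def NoncrossingRel (r : Setoid (Fin n)) : Prop :=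
  ∀ a b c d : Fin n, a < b → b < c → c < d → r a c → r b d → r a b

/-- The classes of `r` and those of `s`, placed on points `0', 1', …` with
`0 < 0' < 1 < 1' < …`, do not cross. -/
def CompatRel (r s : Setoid (Fin n)) : Prop :=
  ∀ a b c d : Fin n, r a c → s b d → ¬ (a ≤ b ∧ b < c ∧ c ≤ d) ∧ ¬ (b < a ∧ a ≤ d ∧ d < c)

/-- The Kreweras complement of an equivalence relation. -/
def krewerasRel (r : Setoid (Fin n)) : Setoid (Fin n) where
  r i j := ∀ a b, r a b →
    (a ∈ Finset.Ioc (min i j) (max i j) ↔ b ∈ Finset.Ioc (min i j) (max i j))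
  iseqv :=
    { refl := by
        intro i a b _
        simp
      symm := by
        intro i j h
        simpa only [min_comm, max_comm] using h
      trans := by
        intro i j k h1 h2 a b hab
        have h1' := h1 a b hab
        have h2' := h2 a b hab
        simp only [Finset.mem_Ioc, min_lt_iff, le_max_iff] at h1' h2' ⊢
        grind }

theorem krewerasRel_iff_of_le {r : Setoid (Fin n)} {i j : Fin n} (hij : i ≤ j) :
    krewerasRel r i j ↔ ∀ a b, r a b → (i < a ∧ a ≤ j ↔ i < b ∧ b ≤ j) := by
  change (∀ a b, r a b → _) ↔ _
  simp only [min_eq_left hij, max_eq_right hij, Finset.mem_Ioc]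

theorem krewerasRel_noncrossing (r : Setoid (Fin n)) : NoncrossingRel (krewerasRel r) := by
  intro a b c d hab hbc hcd hac hbd
  rw [krewerasRel_iff_of_le (by order)] at hac hbd ⊢
  intro i j hij
  have h1 := hac i j hij
  have h2 := hbd i j hij
  grind

theorem compatRel_krewerasRel (r : Setoid (Fin n)) : CompatRel r (krewerasRel r) := by
  intro a b c d hac hbd
  have h := hbd a c hac
  simp only [Finset.mem_Ioc, min_lt_iff, le_max_iff] at h
  grind

theorem CompatRel.le_krewerasRel {r s : Setoid (Fin n)} (h : CompatRel r s) :
    s ≤ krewerasRel r := by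
  intro i j hij a b hab
  have h1 := h a i b j hab hij
  have h2 := h a j b i hab (s.symm hij)
  have h3 := h b i a j (r.symm hab) hij
  have h4 := h b j a i (r.symm hab) (s.symm hij)
  simp only [Finset.mem_Ioc, min_lt_iff, le_max_iff]
  grind

/-- Induction principle for the join: a set closed under `r` and `s` is a union of classes of `r ⊔
s`. -/
theorem Setoid.mem_of_sup_rel {α : Type*} {r s : Setoid α} {i j : α} (h : (r ⊔ s) i j)
    (U : Set α) (hr : ∀ a b, r a b → a ∈ U → b ∈ U) (hs : ∀ a b, s a b → a ∈ U → b ∈ U)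
    (hi : i ∈ U) : j ∈ U := by
  have hle : r ⊔ s ≤ Setoid.comap (· ∈ U) ⊥ := by
    refine sup_le (fun a b hab => ?_) (fun a b hab => ?_)
    · exact propext ⟨hr a b hab, hr b a (r.symm hab)⟩
    · exact propext ⟨hs a b hab, hs b a (s.symm hab)⟩
  have h' : (i ∈ U) = (j ∈ U) := hle h
  rwa [← h']

theorem Fin.exists_greatest {P : Fin n → Prop} (h : ∃ p, P p) : ∃ p, P p ∧ ∀ q, P q → q ≤ p := by
  classical
  have hne : (Finset.univ.filter P).Nonempty := h.imp fun p hp => by simpa using hp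
  exact ⟨_, (Finset.mem_filter.1 (Finset.max'_mem _ hne)).2, fun q hq =>
    Finset.le_max' _ q (by simpa using hq)⟩

theorem Fin.exists_least {P : Fin n → Prop} (h : ∃ p, P p) : ∃ p, P p ∧ ∀ q, P q → p ≤ q := by
  classical
  have hne : (Finset.univ.filter P).Nonempty := h.imp fun p hp => by simpa using hp
  exact ⟨_, (Finset.mem_filter.1 (Finset.min'_mem _ hne)).2, fun q hq =>
    Finset.min'_le _ q (by simpa using hq)⟩

/-- It suffices to connect neighbours `i` and `j = i + 1`. If the class of `j` has an earlier
element, let `p` be the last such one: by noncrossing, `(p, i]` is a union of classes, so the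
complement joins `p` to `i`. Otherwise let `p` be the greatest element of the class: `(i, p]` is a
union of classes, so the complement joins `i` to `p`. In both cases `r` joins `p` to `j`. -/
theorem NoncrossingRel.sup_krewerasRel {r : Setoid (Fin n)} (hr : NoncrossingRel r) :
    r ⊔ krewerasRel r = ⊤ := by
  have hleft : r ≤ r ⊔ krewerasRel r := le_sup_left
  have hright : krewerasRel r ≤ r ⊔ krewerasRel r := le_sup_right
  have hstep : ∀ (k : ℕ) (h : k + 1 < n),
      (r ⊔ krewerasRel r) ⟨k, by omega⟩ ⟨k + 1, h⟩ := by
    intro k h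
    set i : Fin n := ⟨k, by omega⟩ with hi
    set j : Fin n := ⟨k + 1, h⟩ with hj
    have hlt : ∀ a : Fin n, a < j ↔ a ≤ i := by
      intro a
      rw [Fin.lt_def, Fin.le_def]
      simp only [hi, hj]
      omega
    have hlt' : ∀ a : Fin n, i < a ↔ j ≤ a := by
      intro a
      rw [Fin.lt_def, Fin.le_def]
      simp only [hi, hj]
      omega
    by_cases hex : ∃ p, r p j ∧ p < j
    · obtain ⟨p, ⟨hpj, hpj'⟩, hmax⟩ := Fin.exists_greatest hex
      replace hmax := fun q hq hq' => hmax q ⟨hq, hq'⟩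
      have hK : krewerasRel r p i := by
        rw [krewerasRel_iff_of_le ((hlt p).1 hpj')]
        have key : ∀ a b, r a b → p < a ∧ a ≤ i → p < b ∧ b ≤ i := by
          rintro a b hab ⟨hpa, hai⟩
          have haj := (hlt a).2 hai
          have hnot : ¬ r a j := fun h => absurd (hmax a h haj) (not_le.2 hpa)
          have hbp : b ≠ p := fun h => hnot (r.trans (h ▸ hab) hpj)
          have hbj : b ≠ j := fun h => hnot (h ▸ hab)
          refine ⟨?_, (hlt b).1 ?_⟩
          · by_contra! h
            exact hnot (r.trans hab (r.trans (hr b p a j (lt_of_le_of_ne h hbp) hpa haj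
              (r.symm hab) hpj) hpj))
          · by_contra! h
            exact hnot (r.trans (r.symm (hr p a j b hpa haj (lt_of_le_of_ne h hbj.symm) hpj hab))
              hpj)
        exact fun a b hab => ⟨key a b hab, key b a (r.symm hab)⟩
      exact (r ⊔ krewerasRel r).trans (Setoid.symm' _ (hright hK)) (hleft hpj)
    · push Not at hex
      obtain ⟨p, hpj, hmax⟩ := Fin.exists_greatest (P := (r · j)) ⟨j, r.refl j⟩
      have hjp : j ≤ p := hmax j (r.refl j)
      have hip := (hlt' p).2 hjp
      have hK : krewerasRel r i p := by
        rw [krewerasRel_iff_of_le hip.le]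
        have key : ∀ a b, r a b → i < a ∧ a ≤ p → i < b ∧ b ≤ p := by
          rintro a b hab ⟨hia, hap⟩
          by_cases haj : r a j
          · exact ⟨(hlt' b).2 (hex b (r.trans (r.symm hab) haj)),
              hmax b (r.trans (r.symm hab) haj)⟩
          have hbj : ¬ r b j := fun h => haj (r.trans hab h)
          have hja : j < a := lt_of_le_of_ne ((hlt' a).1 hia) (fun h => haj (h ▸ r.refl _))
          have hap' : a < p := lt_of_le_of_ne hap (fun h => haj (h ▸ hpj))
          refine ⟨(hlt' b).2 ?_, ?_⟩
          · by_contra! h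
            exact hbj (hr b j a p h hja hap' (r.symm hab) (r.symm hpj))
          · by_contra! h
            exact haj (r.symm (hr j a p b hja hap' h (r.symm hpj) hab))
        exact fun a b hab => ⟨key a b hab, key b a (r.symm hab)⟩
      exact (r ⊔ krewerasRel r).trans (hright hK) (hleft hpj)
  have hzero : ∀ (k : ℕ) (h : k < n), (r ⊔ krewerasRel r) ⟨0, by omega⟩ ⟨k, h⟩ := by
    intro k
    induction k with
    | zero => exact fun h => Setoid.refl' _ _
    | succ k ih => exact fun h => Setoid.trans' _ (ih (by omega)) (hstep k h)
  exact eq_top_iff.2 fun i j _ =>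
    Setoid.trans' _ (Setoid.symm' _ (hzero i i.2)) (hzero j j.2)

/-- Compatibility gives `s ≤ Kr(r)`. If some class of `Kr(r)` were split by `s`, the intervals
ending at the points of one `s`-class would form a proper set closed under `r` and `s`, contrary to
the join being `⊤`. -/
theorem CompatRel.eq_krewerasRel {r s : Setoid (Fin n)} (h : CompatRel r s) (hsup : r ⊔ s = ⊤) :
    s = krewerasRel r := by
  have hle := h.le_krewerasRel
  refine le_antisymm hle ?_
  have hnc := krewerasRel_noncrossing r
  -- It is enough to join each point to the least element of its class, so that `i` has no
  -- predecessor in the class.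
  suffices hmin : ∀ i j, krewerasRel r i j → (∀ k, krewerasRel r k j → i ≤ k) → s i j by
    intro i j hij
    obtain ⟨k, hmj, hmin'⟩ := Fin.exists_least (P := (krewerasRel r · j)) ⟨i, hij⟩
    exact s.trans (s.symm (hmin k i (Setoid.trans' _ hmj (Setoid.symm' _ hij))
      fun l hl => hmin' l (Setoid.trans' _ hl hij))) (hmin k j hmj hmin')
  intro i j hij hi
  by_contra hsij
  have hij' : i < j := lt_of_le_of_ne (hi j (Setoid.refl' _ j))
    (fun h => hsij (h ▸ s.refl _))
  have hKi : ∀ {t}, s t j → krewerasRel r i t := fun ht =>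
    Setoid.trans' _ hij (Setoid.symm' _ (hle ht))
  -- The set is the union of the intervals `(u, t]`, with `t` in the `s`-class of `j` and `u` the
  -- predecessor of `t` in its `Kr(r)`-class. Such intervals are closed under `r` by definition of
  -- `Kr(r)`, and under `s` because classes of `Kr(r)` do not cross. The set contains `j` but not
  -- `i`.
  have hmem := Setoid.mem_of_sup_rel (r := r) (s := s) (i := j) (j := i) (by rw [hsup]; trivial)
    {p | i < p ∧ ∃ t, s t j ∧ p ≤ t ∧ ∀ u, krewerasRel r u j → u < p ∨ t ≤ u} ?_ ?_
    ⟨hij', j, s.refl j, le_rfl, fun u _ => lt_or_ge u j⟩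
  · exact lt_irrefl _ hmem.1
  · rintro p q hpq ⟨hip, t, htj, hpt, hu⟩
    have h1 := ((krewerasRel_iff_of_le (hip.le.trans hpt)).1 (hKi htj) p q hpq).1 ⟨hip, hpt⟩
    refine ⟨h1.1, t, htj, h1.2, fun u huj => (hu u huj).imp_left fun hup => ?_⟩
    have hut : krewerasRel r u t := Setoid.trans' _ huj (Setoid.symm' _ (hle htj))
    exact (((krewerasRel_iff_of_le (hup.le.trans hpt)).1 hut p q hpq).1 ⟨hup, hpt⟩).1
  · rintro p q hpq ⟨hip, t, htj, hpt, hu⟩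
    by_cases hpj : krewerasRel r p j
    · have hpt' : p = t := le_antisymm hpt ((hu p hpj).resolve_left (lt_irrefl _))
      have hqj : s q j := s.trans (s.symm hpq) (hpt' ▸ htj)
      exact ⟨lt_of_le_of_ne (hi q (hle hqj)) (fun h => hsij (h ▸ hqj)), q, hqj, le_rfl,
        fun u _ => lt_or_ge u q⟩
    · have hKpq : krewerasRel r p q := hle hpq
      have hqj : ¬ krewerasRel r q j := fun h => hpj (Setoid.trans' _ hKpq h)
      have htj' : krewerasRel r t j := hle htj
      have hpt' : p < t := lt_of_le_of_ne hpt (fun h => hpj (h ▸ htj'))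
      have key : ∀ u, krewerasRel r u j → u < p → u < q := by
        intro u huj hup
        by_contra! h
        have hqu : q < u := lt_of_le_of_ne h (fun h => hqj (h ▸ huj))
        exact hqj (Setoid.trans' _ (hnc q u p t hqu hup hpt' (Setoid.symm' _ hKpq)
          (Setoid.trans' _ huj (Setoid.symm' _ htj'))) huj)
      have hqt : q ≤ t := by
        by_contra! h
        exact hpj (Setoid.trans' _ (Setoid.symm' _ (hnc i p t q hip hpt' h (hKi htj) hKpq)) hij)
      exact ⟨key i hij hip, t, htj, hqt, fun u huj => (hu u huj).imp_left (key u huj)⟩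

/-- If classes of the join crossed at `a < b < c < d`, the class of `a` would contain a generating
pair `p, q` with exactly one point inside `(b, d)`; this pair separates `b` from `d`, so the class
of `b` contains a generating pair `u, v` separated by `p, q`. Two pairs of the same relation
contradict its noncrossing, and mixed ones contradict compatibility. -/
theorem NoncrossingRel.sup {r s : Setoid (Fin n)} (hr : NoncrossingRel r) (hs : NoncrossingRel s)
    (h : CompatRel r s) : NoncrossingRel (r ⊔ s) := by
  have hleft : r ≤ r ⊔ s := le_sup_left
  have hright : s ≤ r ⊔ s := le_sup_right
  -- a class that meets both `P` and its complement contains a pair crossing the boundary of `P`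
  have hcross : ∀ (P : Fin n → Prop) (a c : Fin n), (r ⊔ s) a c → P a → ¬ P c →
      ∃ p q, (r p q ∨ s p q) ∧ P p ∧ ¬ P q ∧ (r ⊔ s) a p := by
    intro P a c hac ha hc
    by_contra! hcon
    refine hc (Setoid.mem_of_sup_rel hac {p | P p ∧ (r ⊔ s) a p} ?_ ?_
      ⟨ha, Setoid.refl' _ _⟩).1
    · rintro p q hpq ⟨hp, hap⟩
      refine ⟨?_, Setoid.trans' _ hap (hleft hpq)⟩
      by_contra hq
      exact hcon p q (Or.inl hpq) hp hq hap
    · rintro p q hpq ⟨hp, hap⟩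
      refine ⟨?_, Setoid.trans' _ hap (hright hpq)⟩
      by_contra hq
      exact hcon p q (Or.inr hpq) hp hq hap
  intro a b c d hab hbc hcd hac hbd
  by_contra hnab
  obtain ⟨p, q, hpq, hp, hq, hap⟩ := hcross (fun p => ¬ (b < p ∧ p < d)) a c hac
    (by simp [hab.le]) (by simp [hbc, hcd])
  have hpq' : (r ⊔ s) p q := hpq.elim (fun h => hleft h) (fun h => hright h)
  have hbp : ¬ (r ⊔ s) p b := fun h => hnab (Setoid.trans' _ hap h)
  have hsep : ∀ u, (r ⊔ s) b u → u ≠ p ∧ u ≠ q := fun u hu =>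
    ⟨fun h => hbp (Setoid.symm' _ (h ▸ hu)),
      fun h => hbp (Setoid.trans' _ hpq' (Setoid.symm' _ (h ▸ hu)))⟩
  have hpb := hsep b (Setoid.refl' _ _)
  have hpd := hsep d hbd
  obtain ⟨u, v, huv, hu, hv, hbu⟩ := hcross
    (fun u => (min p q < u ∧ u < max p q ↔ min p q < b ∧ b < max p q)) b d hbd Iff.rfl (by grind)
  have huv' : (r ⊔ s) u v := huv.elim (fun h => hleft h) (fun h => hright h)
  have hup := hsep u hbu
  have hvp := hsep v (Setoid.trans' _ hbu huv')
  -- Both pairs come from one relation; the eight instances cover the orders within the pairs and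
  -- between them.
  have hno : ∀ t : Setoid (Fin n), NoncrossingRel t → t ≤ r ⊔ s → t p q → t u v → False := by
    intro t ht hts h1 h2
    have hup' : ¬ t p u := fun h => hbp (Setoid.trans' _ (hts h) (Setoid.symm' _ hbu))
    have hno' : ∀ p q u v : Fin n, t p q → t u v → ¬ t p u → p < u → u < q → q < v → False :=
      fun p q u v h1 h2 h3 a b c => h3 (ht p u q v a b c h1 h2)
    have h1' := t.symm h1
    have h2' := t.symm h2
    have hne2 : ¬ t p v := fun h => hup' (t.trans h h2')
    have hne3 : ¬ t q u := fun h => hup' (t.trans h1 h)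
    have hne4 : ¬ t q v := fun h => hne2 (t.trans h1 h)
    have hne1' : ¬ t u p := fun h => hup' (t.symm h)
    have hne2' : ¬ t v p := fun h => hne2 (t.symm h)
    have hne3' : ¬ t u q := fun h => hne3 (t.symm h)
    have hne4' : ¬ t v q := fun h => hne4 (t.symm h)
    have k1 := hno' p q u v h1 h2 hup'
    have k2 := hno' p q v u h1 h2' hne2
    have k3 := hno' q p u v h1' h2 hne3
    have k4 := hno' q p v u h1' h2' hne4
    have k5 := hno' u v p q h2 h1 hne1'
    have k6 := hno' v u p q h2' h1 hne2'
    have k7 := hno' u v q p h2 h1' hne3'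
    have k8 := hno' v u q p h2' h1' hne4'
    clear hcross hno' hsep
    grind
  have hno2 : ∀ p q u v : Fin n, r p q → s u v → u ≠ p → u ≠ q → v ≠ p → v ≠ q →
      ((min p q < u ∧ u < max p q) ↔ (min p q < v ∧ v < max p q)) := by
    intro p q u v h1 h2 e1 e2 e3 e4
    have k1 := h p u q v h1 h2
    have k2 := h p v q u h1 (s.symm h2)
    have k3 := h q u p v (r.symm h1) h2
    have k4 := h q v p u (r.symm h1) (s.symm h2)
    grind
  rcases hpq with h1 | h1 <;> rcases huv with h2 | h2
  · exact hno r hr hleft h1 h2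
  · have := hno2 p q u v h1 h2 hup.1 hup.2 hvp.1 hvp.2
    exact hv (this.symm.trans hu)
  · have := hno2 u v p q h2 h1 hup.1.symm hvp.1.symm hup.2.symm hvp.2.symm
    clear hcross hsep hno hno2
    grind
  · exact hno s hs hright h1 h2

end setoids

/-! ### Gluing equivalence relations -/

section glue

variable {n : ℕ} {I : Type*} {m : I → ℕ}

/-- The order embeddings `e i` jointly form a bijection from the disjoint union. -/
def JointlyBijective (e : ∀ i, Fin (m i) ↪o Fin n) : Prop :=
  Function.Bijective fun p : Σ i, Fin (m i) => e p.1 p.2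

variable {e : ∀ i, Fin (m i) ↪o Fin n}

theorem JointlyBijective.exists_eq (he : JointlyBijective e) (j : Fin n) : ∃ i a, e i a = j := by
  obtain ⟨⟨i, a⟩, h⟩ := he.2 j
  exact ⟨i, a, h⟩

theorem JointlyBijective.index_eq (he : JointlyBijective e) {i i' : I} {a : Fin (m i)}
    {b : Fin (m i')} (h : e i a = e i' b) : i = i' :=
  congrArg Sigma.fst (he.1 (a₁ := ⟨i, a⟩) (a₂ := ⟨i', b⟩) h)

/-- The equivalence relation whose restriction to the range of `e i` is `q i`. -/
def glueRel (he : JointlyBijective e) (q : ∀ i, Setoid (Fin (m i))) : Setoid (Fin n) where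
  r j k := ∃ i a b, e i a = j ∧ e i b = k ∧ q i a b
  iseqv :=
    { refl := by
        intro j
        obtain ⟨i, a, h⟩ := he.exists_eq j
        exact ⟨i, a, a, h, h, (q i).refl a⟩
      symm := by
        rintro j k ⟨i, a, b, ha, hb, h⟩
        exact ⟨i, b, a, hb, ha, (q i).symm h⟩
      trans := by
        rintro j k l ⟨i, a, b, ha, hb, h⟩ ⟨i', a', b', ha', hb', h'⟩
        obtain rfl := he.index_eq (hb.trans ha'.symm)
        obtain rfl := (e i).injective (hb.trans ha'.symm)
        exact ⟨i, a, b', ha, hb', (q i).trans h h'⟩ }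

theorem glueRel_apply (he : JointlyBijective e) (q : ∀ i, Setoid (Fin (m i))) (i : I)
    (a b : Fin (m i)) : glueRel he q (e i a) (e i b) ↔ q i a b := by
  constructor
  · rintro ⟨i', a', b', ha, hb, h⟩
    obtain rfl := he.index_eq ha
    rwa [← (e i').injective ha, ← (e i').injective hb]
  · exact fun h => ⟨i, a, b, rfl, rfl, h⟩

theorem comap_glueRel (he : JointlyBijective e) (q : ∀ i, Setoid (Fin (m i))) (i : I) :
    (glueRel he q).comap (e i) = q i :=
  Setoid.ext fun a b => glueRel_apply he q i a b

theorem glueRel_mono (he : JointlyBijective e) {q q' : ∀ i, Setoid (Fin (m i))}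
    (h : ∀ i, q i ≤ q' i) : glueRel he q ≤ glueRel he q' := by
  rintro j k ⟨i, a, b, ha, hb, hab⟩
  exact ⟨i, a, b, ha, hb, h i hab⟩

theorem glueRel_comap (he : JointlyBijective e) {r : Setoid (Fin n)}
    (hr : r ≤ glueRel he fun _ => ⊤) : glueRel he (fun i => r.comap (e i)) = r := by
  refine Setoid.ext fun j k => ⟨?_, fun h => ?_⟩
  · rintro ⟨i, a, b, rfl, rfl, hab⟩
    exact hab
  · obtain ⟨i, a, b, rfl, rfl, -⟩ := hr h
    exact ⟨i, a, b, rfl, rfl, h⟩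

theorem NoncrossingRel.comap {r : Setoid (Fin n)} (hr : NoncrossingRel r) {k : ℕ}
    (f : Fin k ↪o Fin n) : NoncrossingRel (r.comap f) :=
  fun _ _ _ _ hab hbc hcd hac hbd => hr _ _ _ _ (f.lt_iff_lt.2 hab) (f.lt_iff_lt.2 hbc)
    (f.lt_iff_lt.2 hcd) hac hbd

theorem CompatRel.comap {r s : Setoid (Fin n)} (h : CompatRel r s) {k : ℕ}
    (f : Fin k ↪o Fin n) : CompatRel (r.comap f) (s.comap f) := by
  intro a b c d hac hbd
  simpa only [f.le_iff_le, f.lt_iff_lt] using h _ _ _ _ hac hbd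

/-- Crossing classes must lie in the same range, since the ranges do not cross each other; there the
order embedding pulls the crossing back. -/
theorem NoncrossingRel.glueRel {he : JointlyBijective e}
    (hρ : NoncrossingRel (glueRel he fun _ => ⊤)) {q : ∀ i, Setoid (Fin (m i))}
    (hq : ∀ i, NoncrossingRel (q i)) : NoncrossingRel (glueRel he q) := by
  rintro _ _ _ _ hab hbc hcd ⟨i, a, c, rfl, rfl, hac⟩ ⟨i', b, d, rfl, rfl, hbd⟩
  obtain ⟨i'', a', b', ha', hb', -⟩ := hρ _ _ _ _ hab hbc hcd ⟨i, a, c, rfl, rfl, trivial⟩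
    ⟨i', b, d, rfl, rfl, trivial⟩
  obtain rfl := he.index_eq ha'
  obtain rfl := he.index_eq hb'
  rw [OrderEmbedding.lt_iff_lt] at hab hbc hcd
  exact ⟨_, a, b, rfl, rfl, hq _ _ _ _ _ hab hbc hcd hac hbd⟩

/-- For points of different ranges the weak inequalities in `CompatRel` are strict, so a violation
would be a crossing of two ranges. -/
theorem CompatRel.glueRel {he : JointlyBijective e}
    (hρ : NoncrossingRel (glueRel he fun _ => ⊤)) {q s : ∀ i, Setoid (Fin (m i))}
    (hq : ∀ i, CompatRel (q i) (s i)) : CompatRel (glueRel he q) (_root_.glueRel he s) := by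
  rintro _ _ _ _ ⟨i, a, c, rfl, rfl, hac⟩ ⟨i', b, d, rfl, rfl, hbd⟩
  by_cases hi : i = i'
  · subst hi
    simpa only [OrderEmbedding.le_iff_le, OrderEmbedding.lt_iff_lt] using hq _ _ _ _ _ hac hbd
  · have hne : ∀ (a : Fin (m i)) (b : Fin (m i')), e i a ≠ e i' b := fun a b h =>
      hi (he.index_eq h)
    have hcover : ∀ (j : I) (a b : Fin (m j)), _root_.glueRel he (fun _ => ⊤) (e j a) (e j b) :=
      fun j a b => ⟨j, a, b, rfl, rfl, trivial⟩
    have hnot : ∀ (a : Fin (m i)) (b : Fin (m i')),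
        ¬ _root_.glueRel he (fun _ => ⊤) (e i a) (e i' b) := by
      rintro a b ⟨j, a', b', ha', hb', -⟩
      exact hi ((he.index_eq ha').symm.trans (he.index_eq hb'))
    constructor
    · rintro ⟨h1, h2, h3⟩
      exact hnot a b (hρ _ _ _ _ (lt_of_le_of_ne h1 (hne _ _)) h2 (lt_of_le_of_ne h3 (hne _ _))
        (hcover i a c) (hcover i' b d))
    · rintro ⟨h1, h2, h3⟩
      exact hnot a b (Setoid.symm' _ (hρ _ _ _ _ h1 (lt_of_le_of_ne h2 (hne _ _)) h3
        (hcover i' b d) (hcover i a c)))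

theorem glueRel_sup (he : JointlyBijective e) {q s : ∀ i, Setoid (Fin (m i))}
    (h : ∀ i, q i ⊔ s i = ⊤) : glueRel he q ⊔ glueRel he s = glueRel he fun _ => ⊤ := by
  refine le_antisymm (sup_le (glueRel_mono he fun _ => le_top) (glueRel_mono he fun _ => le_top)) ?_
  rintro _ _ ⟨i, a, b, rfl, rfl, -⟩
  have hle : q i ⊔ s i ≤ (glueRel he q ⊔ glueRel he s).comap (e i) := by
    refine sup_le (fun a b hab => ?_) (fun a b hab => ?_)
    · exact (le_sup_left : glueRel he q ≤ _) ((glueRel_apply he q i a b).2 hab)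
    · exact (le_sup_right : glueRel he s ≤ _) ((glueRel_apply he s i a b).2 hab)
  rw [h i] at hle
  exact hle (x := a) (y := b) trivial

/-- Both relations are glued from their restrictions, so their join lies below the gluing of the
restricted joins; restricting back to the range of `e i` gives `⊤`. -/
theorem comap_sup_eq_top (he : JointlyBijective e) {r s : Setoid (Fin n)}
    (h : r ⊔ s = glueRel he fun _ => ⊤) (i : I) : r.comap (e i) ⊔ s.comap (e i) = ⊤ := by
  have hle : r ⊔ s ≤ glueRel he fun i => r.comap (e i) ⊔ s.comap (e i) := by
    refine sup_le ?_ ?_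
    · conv_lhs => rw [← glueRel_comap he (le_sup_left.trans h.le : r ≤ _)]
      exact glueRel_mono he fun _ => le_sup_left
    · conv_lhs => rw [← glueRel_comap he (le_sup_right.trans h.le : s ≤ _)]
      exact glueRel_mono he fun _ => le_sup_right
  rw [h] at hle
  exact eq_top_iff.2 fun a b _ =>
    (glueRel_apply he _ i a b).1 (hle ((glueRel_apply he _ i a b).2 trivial))

/-! ### Products over classes -/

open scoped Classical in
/-- The classes of an equivalence relation on `Fin n`. -/
noncomputable def relClasses (r : Setoid (Fin n)) : Finset (Finset (Fin n)) :=
  (Finpartition.ofSetoid r).parts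

open scoped Classical in
theorem mem_relClasses {r : Setoid (Fin n)} {V : Finset (Fin n)} :
    V ∈ relClasses r ↔ ∃ a, V = Finset.univ.filter (r a) := by
  have hpart : ∀ a, (Finpartition.ofSetoid r).part a = Finset.univ.filter (r a) := by
    intro a
    ext b
    simp [Finpartition.mem_part_ofSetoid_iff_rel]
  constructor
  · intro hV
    obtain ⟨a, ha⟩ := (Finpartition.ofSetoid r).nonempty_of_mem_parts hV
    exact ⟨a, by rw [← hpart, Finpartition.part_eq_of_mem _ hV ha]⟩
  · rintro ⟨a, rfl⟩
    rw [← hpart]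
    exact (Finpartition.part_mem _).2 (Finset.mem_univ a)

theorem rel_of_mem_relClasses {r : Setoid (Fin n)} {V : Finset (Fin n)} (hV : V ∈ relClasses r)
    {a b : Fin n} (ha : a ∈ V) : b ∈ V ↔ r a b := by
  obtain ⟨c, rfl⟩ := mem_relClasses.1 hV
  simp only [Finset.mem_filter, Finset.mem_univ, true_and] at ha ⊢
  exact ⟨fun h => r.trans (r.symm ha) h, fun h => r.trans ha h⟩

theorem exists_mem_relClasses (r : Setoid (Fin n)) (a : Fin n) : ∃ V ∈ relClasses r, a ∈ V := by
  classical
  exact ⟨_, mem_relClasses.2 ⟨a, rfl⟩, by simp⟩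

theorem nonempty_of_mem_relClasses {r : Setoid (Fin n)} {V : Finset (Fin n)}
    (hV : V ∈ relClasses r) : V.Nonempty := by
  classical
  exact Finpartition.nonempty_of_mem_parts _ hV

open scoped Classical in
theorem relClasses_glueRel [Fintype I] (he : JointlyBijective e) (q : ∀ i, Setoid (Fin (m i))) :
    relClasses (glueRel he q) =
      Finset.univ.biUnion fun i => (relClasses (q i)).image (Finset.map (e i).toEmbedding) := by
  have hclass : ∀ i a, Finset.univ.filter (glueRel he q (e i a)) =
      (Finset.univ.filter (q i a)).map (e i).toEmbedding := by
    intro i a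
    ext k
    simp only [Finset.mem_filter, Finset.mem_univ, true_and, Finset.mem_map,
      RelEmbedding.coe_toEmbedding]
    constructor
    · intro h
      obtain ⟨i', a', b, ha', rfl, hab⟩ := h
      obtain rfl := he.index_eq ha'
      obtain rfl := (e i').injective ha'
      exact ⟨b, hab, rfl⟩
    · rintro ⟨b, hab, rfl⟩
      exact (glueRel_apply he q i a b).2 hab
  ext V
  simp only [mem_relClasses, Finset.mem_biUnion, Finset.mem_univ, true_and, Finset.mem_image]
  constructor
  · rintro ⟨j, rfl⟩
    obtain ⟨i, a, rfl⟩ := he.exists_eq j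
    exact ⟨i, _, ⟨a, rfl⟩, (hclass i a).symm⟩
  · rintro ⟨i, _, ⟨a, rfl⟩, rfl⟩
    exact ⟨e i a, (hclass i a).symm⟩

theorem prod_relClasses_glueRel [Fintype I] (he : JointlyBijective e)
    (q : ∀ i, Setoid (Fin (m i))) (F : Finset (Fin n) → ℂ) :
    ∏ V ∈ relClasses (glueRel he q), F V =
      ∏ i, ∏ V ∈ relClasses (q i), F (V.map (e i).toEmbedding) := by
  classical
  rw [relClasses_glueRel, Finset.prod_biUnion]
  · refine Finset.prod_congr rfl fun i _ => Finset.prod_image fun V _ W _ h => ?_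
    exact Finset.map_injective _ h
  · intro i _ j _ hij
    refine Finset.disjoint_left.2 fun V h1 h2 => hij ?_
    obtain ⟨W, hW, rfl⟩ := Finset.mem_image.1 h1
    obtain ⟨W', -, h⟩ := Finset.mem_image.1 h2
    obtain ⟨a, ha⟩ := nonempty_of_mem_relClasses hW
    have : e i a ∈ W'.map (e j).toEmbedding := h ▸ Finset.mem_map_of_mem _ ha
    obtain ⟨b, -, hb⟩ := Finset.mem_map.1 this
    exact (he.index_eq hb).symm

theorem sort_map_map {k : ℕ} {β : Type*} (f : Fin k ↪o Fin n) (V : Finset (Fin k))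
    (u : Fin n → β) :
    (V.map f.toEmbedding).sort.map u = V.sort.map fun j => u (f j) := by
  rw [← Finset.map_sort f.toEmbedding V (· ≤ ·) (· ≤ ·)
    (fun a _ b _ => f.le_iff_le.symm), List.map_map]
  rfl

theorem prod_relClasses_glueRel_word [Fintype I] (he : JointlyBijective e)
    (q : ∀ i, Setoid (Fin (m i))) {β : Type*} (f : List β → ℂ) (u : Fin n → β) :
    ∏ V ∈ relClasses (glueRel he q), f (V.sort.map u) =
      ∏ i, ∏ V ∈ relClasses (q i), f (V.sort.map fun j => u (e i j)) := by
  simp only [prod_relClasses_glueRel, sort_map_map]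

end glue

/-! ### Sums over noncrossing equivalence relations -/

section sums

variable {n : ℕ}

noncomputable instance : Fintype (Setoid (Fin n)) :=
  Fintype.ofInjective (fun r : Setoid (Fin n) => relClasses r) (by
    intro r s h
    replace h : relClasses r = relClasses s := h
    refine Setoid.ext fun a b => ?_
    obtain ⟨V, hV, ha⟩ := exists_mem_relClasses r a
    exact (rel_of_mem_relClasses hV ha).symm.trans
      (rel_of_mem_relClasses (h ▸ hV : V ∈ relClasses s) ha))

open scoped Classical in
/-- The noncrossing equivalence relations on `Fin n`. -/
noncomputable def noncrossingRels (n : ℕ) : Finset (Setoid (Fin n)) :=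
  Finset.univ.filter NoncrossingRel

theorem mem_noncrossingRels {r : Setoid (Fin n)} : r ∈ noncrossingRels n ↔ NoncrossingRel r := by
  simp [noncrossingRels]

open scoped Classical in
theorem isNoncrossing_ofSetoid {r : Setoid (Fin n)} :
    IsNoncrossing (Finpartition.ofSetoid r) ↔ NoncrossingRel r := by
  constructor
  · intro h a b c d hab hbc hcd hac hbd
    obtain ⟨V, hV, ha⟩ := exists_mem_relClasses r a
    obtain ⟨W, hW, hb⟩ := exists_mem_relClasses r b
    have := h V hV W hW a b c d hab hbc hcd ha ((rel_of_mem_relClasses hV ha).2 hac) hb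
      ((rel_of_mem_relClasses hW hb).2 hbd)
    exact (rel_of_mem_relClasses hV ha).1 (this ▸ hb)
  · intro h V hV W hW a b c d hab hbc hcd ha hc hb hd
    refine Finpartition.eq_of_mem_parts _ hV hW ?_ hb
    exact (rel_of_mem_relClasses hV ha).2 (h a b c d hab hbc hcd
      ((rel_of_mem_relClasses hV ha).1 hc) ((rel_of_mem_relClasses hW hb).1 hd))

open scoped Classical in
theorem kreweras_ofSetoid (r : Setoid (Fin n)) :
    (kreweras (Finpartition.ofSetoid r)).parts = relClasses (krewerasRel r) := by
  have : krewerasSetoid (Finpartition.ofSetoid r) = krewerasRel r := by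
    refine Setoid.ext fun i j => ⟨fun h a b hab => ?_, fun h V hV a ha b hb => ?_⟩
    · obtain ⟨V, hV, ha⟩ := exists_mem_relClasses r a
      exact h V hV a ha b ((rel_of_mem_relClasses hV ha).2 hab)
    · exact h a b ((rel_of_mem_relClasses hV ha).1 hb)
  unfold kreweras relClasses
  rw [this]

open scoped Classical in
theorem sum_NC_eq_sum_noncrossingRels {M : Type*} [AddCommMonoid M]
    (G : Finpartition (Finset.univ : Finset (Fin n)) → M) :
    ∑ π ∈ NC n, G π = ∑ r ∈ noncrossingRels n, G (Finpartition.ofSetoid r) := by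
  symm
  refine Finset.sum_bij (fun r _ => Finpartition.ofSetoid r) ?_ ?_ ?_ (fun _ _ => rfl)
  · intro r hr
    exact mem_NC.2 (isNoncrossing_ofSetoid.2 (mem_noncrossingRels.1 hr))
  · intro r _ s _ h
    refine Setoid.ext fun a b => ?_
    rw [← r.comm', ← s.comm', ← Finpartition.mem_part_ofSetoid_iff_rel (s := r),
      ← Finpartition.mem_part_ofSetoid_iff_rel (s := s), h]
  · intro π hπ
    -- The preimage of `π` is the relation of having the same block.
    have hr : Finpartition.ofSetoid (Setoid.ker π.part) = π := by
      have hle : ∀ V ∈ π.parts, V ∈ (Finpartition.ofSetoid (Setoid.ker π.part)).parts := by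
        intro V hV
        obtain ⟨a, ha⟩ := π.nonempty_of_mem_parts hV
        refine mem_relClasses.2 ⟨a, ?_⟩
        ext b
        simp only [Finset.mem_filter, Finset.mem_univ, true_and, Setoid.ker_def]
        rw [π.part_eq_of_mem hV ha, eq_comm, π.part_eq_iff_mem hV]
      refine Finpartition.ext (Finset.Subset.antisymm (fun V hV => ?_) hle)
      obtain ⟨a, ha⟩ := Finpartition.nonempty_of_mem_parts _ hV
      have h1 := π.part_mem.2 (Finset.mem_univ a)
      rwa [Finpartition.eq_of_mem_parts _ hV (hle _ h1) ha (π.mem_part (Finset.mem_univ a))]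
    exact ⟨_, mem_noncrossingRels.2 (isNoncrossing_ofSetoid.1 (by rw [hr]; exact mem_NC.1 hπ)), hr⟩

end sums

/-! ### Moments of products of free elements -/

section products

variable {A : Type*} [Ring A] [Algebra ℂ A] {φ : A →ₗ[ℂ] ℂ} {n : ℕ}

theorem moment_eq_sum_noncrossingRels (φ : A →ₗ[ℂ] ℂ) (hn : n ≠ 0) (a : Fin n → A) :
    φ (List.ofFn a).prod = ∑ r ∈ noncrossingRels n,
      ∏ V ∈ relClasses r, scalarCumulant φ (V.sort.map a) := by
  rw [moment_eq_sum_prod φ hn, sum_NC_eq_sum_noncrossingRels]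
  rfl

/-- The embeddings `i ↦ 2 i` and `i ↦ 2 i + 1`. -/
def doubleEmb (n : ℕ) (ε : Fin 2) : Fin n ↪o Fin (n * 2) :=
  OrderEmbedding.ofStrictMono (fun i => ⟨i * 2 + ε, by omega⟩) (by
    intro i j h
    rw [Fin.lt_def] at h ⊢
    simp only
    omega)

theorem doubleEmb_val (ε : Fin 2) (i : Fin n) : (doubleEmb n ε i : ℕ) = i * 2 + ε := rfl

theorem doubleEmb_mod_div (j : Fin (n * 2)) :
    doubleEmb n ⟨j % 2, by omega⟩ ⟨j / 2, by omega⟩ = j :=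
  Fin.ext (by simp only [doubleEmb_val]; omega)

theorem jointlyBijective_doubleEmb (n : ℕ) :
    JointlyBijective (m := fun _ : Fin 2 => n) (doubleEmb n) := by
  constructor
  · rintro ⟨ε, i⟩ ⟨ε', i'⟩ h
    have h' : (i : ℕ) * 2 + ε = i' * 2 + ε' := congrArg Fin.val h
    obtain rfl : ε = ε' := Fin.ext (by omega)
    obtain rfl : i = i' := Fin.ext (by omega)
    rfl
  · intro j
    exact ⟨⟨_, _⟩, doubleEmb_mod_div j⟩

/-- With `i` at `2 i` and `i'` at `2 i + 1`, the order `0 < 0' < 1 < 1' < …` becomes the usual one: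
classes of opposite parity are kept from crossing by `CompatRel`. -/
theorem noncrossingRel_glue_doubleEmb {r s : Setoid (Fin n)} (hr : NoncrossingRel r)
    (hs : NoncrossingRel s) (h : CompatRel r s) :
    NoncrossingRel (glueRel (jointlyBijective_doubleEmb n) ![r, s]) := by
  rintro _ _ _ _ hab hbc hcd ⟨ε, a, c, rfl, rfl, hac⟩ ⟨ε', b, d, rfl, rfl, hbd⟩
  have hlt : ∀ (ε ε' : Fin 2) (i j : Fin n), doubleEmb n ε i < doubleEmb n ε' j ↔
      (i : ℕ) * 2 + ε < j * 2 + ε' := fun _ _ _ _ => Iff.rfl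
  rw [hlt] at hab hbc hcd
  fin_cases ε <;> fin_cases ε'
  · refine (glueRel_apply (jointlyBijective_doubleEmb n) ![r, s] 0 a b).2 (hr a b c d ?_ ?_ ?_ hac hbd) <;> rw [Fin.lt_def] <;>
      simp at hab hbc hcd <;> omega
  · refine absurd ?_ (h a b c d hac hbd).1
    simp only [Fin.le_def, Fin.lt_def]
    simp at hab hbc hcd
    omega
  · refine absurd ?_ (h b a d c hbd hac).2
    simp only [Fin.le_def, Fin.lt_def]
    simp at hab hbc hcd
    omega
  · refine (glueRel_apply (jointlyBijective_doubleEmb n) ![r, s] 1 a b).2 (hs a b c d ?_ ?_ ?_ hac hbd) <;> rw [Fin.lt_def] <;>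
      simp at hab hbc hcd <;> omega

theorem compatRel_comap_doubleEmb {t : Setoid (Fin (n * 2))} (ht : NoncrossingRel t)
    (hle : t ≤ glueRel (jointlyBijective_doubleEmb n) fun _ => ⊤) :
    CompatRel (t.comap (doubleEmb n 0)) (t.comap (doubleEmb n 1)) := by
  have hnot : ∀ i j, ¬ t (doubleEmb n 0 i) (doubleEmb n 1 j) := by
    intro i j h
    obtain ⟨ε, i', j', hi, hj, -⟩ := hle h
    have h0 := (jointlyBijective_doubleEmb n).index_eq hi
    have h1 := (jointlyBijective_doubleEmb n).index_eq hj
    exact absurd (h0.symm.trans h1) (by decide)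
  have hlt : ∀ (ε ε' : Fin 2) (i j : Fin n), doubleEmb n ε i < doubleEmb n ε' j ↔
      (i : ℕ) * 2 + ε < j * 2 + ε' := fun _ _ _ _ => Iff.rfl
  intro a b c d hac hbd
  constructor
  · rintro ⟨h1, h2, h3⟩
    rw [Fin.le_def] at h1 h3
    rw [Fin.lt_def] at h2
    refine hnot a b (ht _ _ _ _ ?_ ?_ ?_ hac hbd) <;> rw [hlt] <;> simp <;> omega
  · rintro ⟨h1, h2, h3⟩
    rw [Fin.lt_def] at h1 h3
    rw [Fin.le_def] at h2
    refine hnot a b (t.symm (ht _ _ _ _ ?_ ?_ ?_ hbd hac)) <;> rw [hlt] <;> simp <;> omega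

open scoped Classical in
/-- The pairs of noncrossing equivalence relations which do not cross each other. -/
noncomputable def compatPairs (n : ℕ) : Finset (Setoid (Fin n) × Setoid (Fin n)) :=
  (noncrossingRels n ×ˢ noncrossingRels n).filter fun p => CompatRel p.1 p.2

theorem mem_compatPairs {p : Setoid (Fin n) × Setoid (Fin n)} : p ∈ compatPairs n ↔
    NoncrossingRel p.1 ∧ NoncrossingRel p.2 ∧ CompatRel p.1 p.2 := by
  simp [compatPairs, mem_noncrossingRels, and_assoc]

/-- The product is a word of length `2 n` with the `a i` at even and the `b i` at odd positions.
Partitions joining the two parities have a mixed cumulant as a factor; the others are glued from a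
compatible pair. -/
theorem IsFree.map_prod_mul {X Y : Set A} (h : IsFree φ ![X, Y]) (hn : n ≠ 0) {a b : Fin n → A}
    (ha : ∀ i, a i ∈ X) (hb : ∀ i, b i ∈ Y) :
    φ (List.ofFn fun i => a i * b i).prod =
      ∑ p ∈ compatPairs n, (∏ V ∈ relClasses p.1, scalarCumulant φ (V.sort.map a)) *
        ∏ V ∈ relClasses p.2, scalarCumulant φ (V.sort.map b) := by
  classical
  let z : Fin (n * 2) → A := fun j =>
    if (j : ℕ) % 2 = 0 then a ⟨j / 2, by omega⟩ else b ⟨j / 2, by omega⟩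
  have hz0 : ∀ i, z (doubleEmb n 0 i) = a i := by
    intro i
    simp [z, doubleEmb_val]
  have hz1 : ∀ i, z (doubleEmb n 1 i) = b i := by
    intro i
    have h1 : ((i : ℕ) * 2 + 1) % 2 = 1 := by omega
    have h2 : ((i : ℕ) * 2 + 1) / 2 = i := by omega
    simp [z, doubleEmb_val, h1, h2]
  have hprod : (List.ofFn fun i => a i * b i).prod = (List.ofFn z).prod := by
    rw [List.ofFn_mul, List.prod_flatten, List.map_ofFn]
    congr 2
    funext i
    rw [Function.comp_apply, List.ofFn_succ, List.ofFn_succ, List.ofFn_zero]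
    simp only [List.prod_cons, List.prod_nil, mul_one]
    rw [← hz0, ← hz1]
    rfl
  set he := jointlyBijective_doubleEmb n
  rw [hprod, moment_eq_sum_noncrossingRels φ (by omega),
    ← Finset.sum_filter_of_ne (p := fun t => t ≤ glueRel he fun _ => ⊤)]
  · refine Finset.sum_bij'
      (fun t _ => (t.comap (doubleEmb n 0), t.comap (doubleEmb n 1)))
      (fun p _ => glueRel he ![p.1, p.2]) ?_ ?_ ?_ ?_ ?_
    · intro t ht
      obtain ⟨ht, hle⟩ := Finset.mem_filter.1 ht
      have ht := mem_noncrossingRels.1 ht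
      exact mem_compatPairs.2 ⟨ht.comap _, ht.comap _, compatRel_comap_doubleEmb ht hle⟩
    · intro p hp
      obtain ⟨h1, h2, h3⟩ := mem_compatPairs.1 hp
      exact Finset.mem_filter.2 ⟨mem_noncrossingRels.2 (noncrossingRel_glue_doubleEmb h1 h2 h3),
        glueRel_mono he fun _ => le_top⟩
    · intro t ht
      conv_rhs => rw [← glueRel_comap he (Finset.mem_filter.1 ht).2]
      congr 1
      funext ε
      fin_cases ε <;> rfl
    · intro p _
      exact Prod.ext (comap_glueRel he _ 0) (comap_glueRel he _ 1)
    · intro t ht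
      conv_lhs => rw [← glueRel_comap he (Finset.mem_filter.1 ht).2, prod_relClasses_glueRel_word]
      rw [Fin.prod_univ_two]
      simp only [hz0, hz1]
  -- A block containing both parities would make the term zero.
  · intro t _ hne i j hij
    by_contra hcon
    obtain ⟨V, hV, hi⟩ := exists_mem_relClasses t i
    have hj := (rel_of_mem_relClasses hV hi).2 hij
    refine hne (Finset.prod_eq_zero hV ?_)
    have hpar : (i : ℕ) % 2 ≠ j % 2 := by
      intro hpar
      apply hcon
      have hj2 : (j : ℕ) / 2 < n := by omega
      refine ⟨_, _, ⟨j / 2, hj2⟩, doubleEmb_mod_div i, ?_, trivial⟩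
      simp only [hpar]
      exact doubleEmb_mod_div j
    refine h.scalarCumulant_map_eq_zero _ (fun j : Fin (n * 2) => (j : ℕ) % 2 = 0) z (fun j _ hj => ?_)
      (fun j _ hj => ?_) ?_ ?_
    · simpa [z, hj] using ha _
    · simpa [z, hj] using hb _
    · rcases Nat.mod_two_eq_zero_or_one i with h0 | h0
      · exact ⟨i, (Finset.mem_sort _).2 hi, h0⟩
      · exact ⟨j, (Finset.mem_sort _).2 hj, by omega⟩
    · rcases Nat.mod_two_eq_zero_or_one i with h0 | h0
      · exact ⟨j, (Finset.mem_sort _).2 hj, by omega⟩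
      · exact ⟨i, (Finset.mem_sort _).2 hi, by omega⟩

end products

/-! ### Boxed convolution -/

section boxed

variable {ι : Type*}

open scoped Classical in
theorem boxedConv_apply (f g : FormalSeries ι) {n : ℕ} (hn : n ≠ 0) (a : Fin n → ι) :
    (FormalSeries.boxedConv f g).1 (List.ofFn a) = ∑ r ∈ noncrossingRels n,
      (∏ V ∈ relClasses r, f.1 (V.sort.map a)) *
        ∏ V ∈ relClasses (krewerasRel r), g.1 (V.sort.map a) := by
  have key : ∀ (l : List ι) (h : l.length = n), (∀ i : Fin n, l.get (i.cast h.symm) = a i) →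
      ∑ π ∈ NC l.length, multExt f.1 l π * multExt g.1 l (kreweras π) =
        ∑ r ∈ noncrossingRels n, (∏ V ∈ relClasses r, f.1 (V.sort.map a)) *
          ∏ V ∈ relClasses (krewerasRel r), g.1 (V.sort.map a) := by
    intro l h hl
    subst h
    have : l.get = a := funext hl
    subst this
    rw [sum_NC_eq_sum_noncrossingRels]
    refine Finset.sum_congr rfl fun r _ => ?_
    unfold multExt
    rw [kreweras_ofSetoid]
    rfl
  have hne : List.ofFn a ≠ [] := by simpa using hn
  refine (if_neg hne).trans (key _ (List.length_ofFn) (by simp))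

/-- The classes of a relation, enumerated in increasing order. -/
theorem jointlyBijective_relClasses {n : ℕ} (r : Setoid (Fin n)) :
    JointlyBijective (I := relClasses r) (m := fun V => V.1.card)
      fun V => V.1.orderEmbOfFin rfl := by
  constructor
  · rintro ⟨⟨V, hV⟩, a⟩ ⟨⟨W, hW⟩, b⟩ h
    have h' : V.orderEmbOfFin rfl a = W.orderEmbOfFin rfl b := h
    have hVW : V = W := by
      classical
      exact Finpartition.eq_of_mem_parts _ hV hW (Finset.orderEmbOfFin_mem V rfl a)
        (h' ▸ Finset.orderEmbOfFin_mem W rfl b)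
    subst hVW
    rw [(V.orderEmbOfFin rfl).injective h']
  · intro j
    obtain ⟨V, hV, hj⟩ := exists_mem_relClasses r j
    have : j ∈ Set.range (V.orderEmbOfFin rfl) := by rwa [Finset.range_orderEmbOfFin]
    obtain ⟨a, ha⟩ := this
    exact ⟨⟨⟨V, hV⟩, a⟩, ha⟩

theorem glueRel_relClasses_top {n : ℕ} (r : Setoid (Fin n)) :
    glueRel (jointlyBijective_relClasses r) (fun _ => ⊤) = r := by
  refine Setoid.ext fun i j => ⟨?_, fun h => ?_⟩
  · rintro ⟨⟨V, hV⟩, a, b, rfl, rfl, -⟩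
    exact (rel_of_mem_relClasses hV (Finset.orderEmbOfFin_mem V rfl a)).1
      (Finset.orderEmbOfFin_mem V rfl b)
  · obtain ⟨V, hV, hi⟩ := exists_mem_relClasses r i
    have hj := (rel_of_mem_relClasses hV hi).2 h
    rw [← Finset.mem_coe, ← Finset.range_orderEmbOfFin V rfl] at hi hj
    obtain ⟨a, ha⟩ := hi
    obtain ⟨b, hb⟩ := hj
    exact ⟨⟨V, hV⟩, a, b, ha, hb, trivial⟩

/-- The pairs are sorted by their join `ρ`. Those with join `ρ` are glued from independent choices
on the blocks of `ρ`, each a compatible pair with join `⊤`, that is, a relation together with its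
Kreweras complement. -/
theorem sum_compatPairs (f g : FormalSeries ι) {n : ℕ} (a : Fin n → ι) :
    ∑ p ∈ compatPairs n, (∏ V ∈ relClasses p.1, f.1 (V.sort.map a)) *
        ∏ V ∈ relClasses p.2, g.1 (V.sort.map a) =
      ∑ r ∈ noncrossingRels n, ∏ V ∈ relClasses r,
        (FormalSeries.boxedConv f g).1 (V.sort.map a) := by
  classical
  rw [← Finset.sum_fiberwise_of_maps_to (g := fun p => p.1 ⊔ p.2) (t := noncrossingRels n)]
  · refine Finset.sum_congr rfl fun ρ hρ => ?_
    have hρ := mem_noncrossingRels.1 hρ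
    set he := jointlyBijective_relClasses ρ
    have hρe : glueRel he (fun _ => ⊤) = ρ := glueRel_relClasses_top ρ
    have hρ' : NoncrossingRel (glueRel he fun _ => ⊤) := by rwa [hρe]
    have hbox : ∀ V : relClasses ρ, (FormalSeries.boxedConv f g).1 (V.1.sort.map a) =
        ∑ r ∈ noncrossingRels V.1.card,
          (∏ W ∈ relClasses r, f.1 (W.sort.map fun j => a (V.1.orderEmbOfFin rfl j))) *
          ∏ W ∈ relClasses (krewerasRel r),
            g.1 (W.sort.map fun j => a (V.1.orderEmbOfFin rfl j)) := by
      intro V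
      rw [sort_map_eq_ofFn]
      exact boxedConv_apply f g (Finset.card_ne_zero.2 (nonempty_of_mem_relClasses V.2)) _
    rw [← Finset.prod_coe_sort (relClasses ρ)]
    simp only [hbox]
    rw [Finset.prod_univ_sum]
    symm
    -- Only the first component needs restricting to recover the choice, as `eq_krewerasRel`
    -- determines the second on every block.
    refine Finset.sum_bij'
      (fun q _ => (glueRel he q, glueRel he fun V => krewerasRel (q V)))
      (fun p _ V => p.1.comap (V.1.orderEmbOfFin rfl)) ?_ ?_ ?_ ?_ ?_
    · intro q hq
      have hq : ∀ V, NoncrossingRel (q V) := fun V =>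
        mem_noncrossingRels.1 (Fintype.mem_piFinset.1 hq V)
      refine Finset.mem_filter.2 ⟨mem_compatPairs.2 ⟨hρ'.glueRel hq,
        hρ'.glueRel fun V => krewerasRel_noncrossing _,
        CompatRel.glueRel hρ' fun V => compatRel_krewerasRel _⟩, ?_⟩
      exact (glueRel_sup he fun V => (hq V).sup_krewerasRel).trans hρe
    · intro p hp
      obtain ⟨hp, -⟩ := Finset.mem_filter.1 hp
      exact Fintype.mem_piFinset.2 fun V =>
        mem_noncrossingRels.2 ((mem_compatPairs.1 hp).1.comap _)
    · intro q _
      funext V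
      exact comap_glueRel he q V
    · intro p hp
      obtain ⟨hp, hsup⟩ := Finset.mem_filter.1 hp
      obtain ⟨h1, h2, h3⟩ := mem_compatPairs.1 hp
      have hsup' := hsup.trans hρe.symm
      refine Prod.ext (glueRel_comap he (le_sup_left.trans hsup'.le)) ?_
      conv_rhs => rw [← glueRel_comap he (le_sup_right.trans hsup'.le : p.2 ≤ _)]
      have : (fun V : relClasses ρ => krewerasRel (p.1.comap (V.1.orderEmbOfFin rfl))) =
          fun V : relClasses ρ => p.2.comap (V.1.orderEmbOfFin rfl) := by
        funext V
        exact ((h3.comap _).eq_krewerasRel (comap_sup_eq_top he hsup' V)).symm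
      exact congrArg (glueRel he) this
    · intro q _
      rw [Finset.prod_mul_distrib]
      simp only
      rw [prod_relClasses_glueRel_word, prod_relClasses_glueRel_word]
  · intro p hp
    obtain ⟨h1, h2, h3⟩ := mem_compatPairs.1 hp
    exact mem_noncrossingRels.2 (h1.sup h2 h3)

/-- The coefficients of the boxed convolution satisfy the moment-cumulant formula for the products
`x i * y i`; by induction on the length this formula determines them. -/
theorem IsFree.rTransform_mul {A : Type*} [Ring A] [Algebra ℂ A] {φ : A →ₗ[ℂ] ℂ} {x y : ι → A}
    (h : IsFree φ ![Set.range x, Set.range y]) :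
    rTransform φ (fun i => x i * y i) =
      FormalSeries.boxedConv (rTransform φ x) (rTransform φ y) := by
  classical
  have hr : ∀ (z : ι → A) (w : List ι), w ≠ [] →
      (rTransform φ z).1 w = scalarCumulant φ (w.map z) := fun z w hw => if_neg hw
  suffices key : ∀ (n : ℕ) (a : Fin n → ι), n ≠ 0 →
      scalarCumulant φ (List.ofFn fun i => x (a i) * y (a i)) =
        (FormalSeries.boxedConv (rTransform φ x) (rTransform φ y)).1 (List.ofFn a) by
    refine Subtype.ext (funext fun w => ?_)
    by_cases hw : w = []
    · rw [hw, (rTransform φ _).2, (FormalSeries.boxedConv _ _).2]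
    · rw [hr _ w hw]
      conv_lhs => rw [← List.ofFn_get w, List.map_ofFn]
      conv_rhs => rw [← List.ofFn_get w]
      exact key _ _ (by simpa using hw)
  intro n
  induction n using Nat.strong_induction_on with
  | _ n ih =>
  intro a hn
  have hmom : φ (List.ofFn fun i => x (a i) * y (a i)).prod = ∑ π ∈ NC n, ∏ V ∈ π.parts,
      (FormalSeries.boxedConv (rTransform φ x) (rTransform φ y)).1 (V.sort.map a) := by
    rw [h.map_prod_mul hn (fun i => ⟨a i, rfl⟩) (fun i => ⟨a i, rfl⟩),
      sum_NC_eq_sum_noncrossingRels]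
    refine Eq.trans (Finset.sum_congr rfl fun p _ => ?_) (sum_compatPairs _ _ a)
    have hz : ∀ (z : ι → A) (r : Setoid (Fin n)),
        ∏ V ∈ relClasses r, scalarCumulant φ (V.sort.map fun i => z (a i)) =
          ∏ V ∈ relClasses r, (rTransform φ z).1 (V.sort.map a) := by
      intro z r
      refine Finset.prod_congr rfl fun V hV => ?_
      rw [hr, List.map_map]
      · rfl
      · obtain ⟨i, hi⟩ := nonempty_of_mem_relClasses hV
        simpa using List.ne_nil_of_mem ((Finset.mem_sort (· ≤ ·)).2 hi)
    rw [hz, hz]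
  rw [scalarCumulant_ofFn φ hn, hmom, sum_NC_eq (Nat.pos_of_ne_zero hn) _
    ((FormalSeries.boxedConv (rTransform φ x) (rTransform φ y)).1 (List.ofFn a)), sub_eq_iff_eq_add]
  · congr 1
    refine Finset.sum_congr rfl fun π hπ => Finset.prod_congr rfl fun V hV => ?_
    rw [sort_map_eq_ofFn, sort_map_eq_ofFn]
    exact (ih _ (part_card_lt π (Finset.mem_filter.1 hπ).2 hV) _
      (Finset.card_ne_zero.2 (π.nonempty_of_mem_parts hV))).symm
  · intro π hπ
    rw [hπ, Finset.prod_singleton, Fin.sort_univ, List.ofFn_eq_map]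

end boxed

/-! ### The main theorem, from scalar freeness of the two families -/

theorem mainTheorem4 {A : Type*} [Ring A] [Algebra ℂ A] (B : Subalgebra ℂ A)
    (φ : A →ₗ[ℂ] ℂ) (hφ : φ 1 = 1)
    (E : A →ₗ[ℂ] B) (hE : IsBFunctional E)
    (hcomp : Compatible φ E)
    (s : ℕ) (x y : Fin s → A)
    (hxy : IsBFree E ![Set.range x, Set.range y])
    (hfree : IsFree φ ![Set.range x ∪ Set.range y, (B : Set A)]) :
    rTransform φ (Fin.append x y) =
        FormalSeries.rename (Fin.castAddEmb s) (rTransform φ x) +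
          FormalSeries.rename (Fin.natAddEmb s) (rTransform φ y) ∧
      rTransform φ (fun i => x i + y i) = rTransform φ x + rTransform φ y ∧
      rTransform φ (fun i => x i * y i) =
        FormalSeries.boxedConv (rTransform φ x) (rTransform φ y) := by
  have h : IsFree φ ![Set.range x, Set.range y] :=
    hxy.isFree hE hcomp hφ (by intro i; fin_cases i <;> simp) hfree
  exact ⟨h.rTransform_append, h.rTransform_add, h.rTransform_mul⟩
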